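/- Let $G=(V,E)$ be a finite, simple, connected graph with $n=|V|\ge 2$ nodes, and let $h(G)$ be its Hadwiger number, i.e. the largest $k$ such that the complete graph $K_k$ is a minor of $G$. For $u,v\in V$ let $I(u,v)$ be the set of all nodes lying on some shortest $u$–$v$ path. A set $C\subseteq V$ is convex if $I(a,b)\subseteq C$ for all $a,b\in C$; a labeling $y:V\to\{0,1\}$ is convex if $y^{-1}(0)$ and $y^{-1}(1)$ are both convex; and $y$ is $M$-near-convex if it can be turned into a convex labeling by flipping the labels of at most $M$ nodes. A good quadruple in $U\subseteq V$ is an unordered pair $\{(a,b),(c,d)\}$ of unordered pairs, where $a,b,c,d\in U$ are distinct and $I(a,b)\cap I(c,d)\ne\emptyset$. In self-directed learning of an unknown labeling $y:V\to\{0,1\}$, the learner, in each of $n$ trials, selects a not yet selected node $v$, predicts a label $\hat y(v)$ and then observes $y(v)$; it makes a mistake if $\hat y(v)\neq y(v)$. The learner Good4 knows $G$ and works as follows. (Whenever a node is predicted, its label is observed and it is removed from the set $U$ of unlabeled nodes.) Start with $U=V$. While there is a good quadruple in $U$, do: 1. Select a node $a\in U$ that participates in the largest number of good quadruples in $U$,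 predict its label arbitrarily, and put $\tilde y=y(a)$. 2. With $U$ now fixed as $W$, rank the nodes $b'\in W$ by the number of pairs $(c,d)$ such that $\{(a,b'),(c,d)\}$ is a good quadruple in $W\cup\{a\}$. Go through these nodes in decreasing order, predicting $1-\tilde y$ for each, until a mistake is made on some node $b$ or $U$ is empty. If there is no mistake, end this iteration. 3. With $U$ now fixed as $W$, rank the nodes $c'\in W$ by the number of nodes $d$ such that $\{(a,b),(c',d)\}$ is a good quadruple in $W\cup\{a,b\}$. Go through these nodes in decreasing order, predicting $\tilde y$ for each, until a mistake is made on some node $c$ or $U$ is empty. If there is no mistake, end this iteration. 4. Go through the nodes $d\in U$ such that $\{(a,b),(c,d)\}$ is a good quadruple, in any order, predicting $\tilde y$ for each, and stop after the first mistake. When there is no good quadruple in $U$ any more, predict arbitrary labels for the remaining nodes of $U$, in any order. **Theorem.** Good4 can always be carried out, and however ties, orders of iteration and arbitrary predictions are resolved, for every labeling $y:V\to\{0,1\}$ it selects every node exactly once, hence predicts all labels, and it makes at most $$4M^*+3\,(h(G)+1)^4\ln n$$ mistakes, where $M^*$ is the smallest integer such that $y$ is $M^*$-near-convex. The algorithm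 depends on neither $y$ (beyond the labels observed so far) nor $M^*$. -/

import Mathlib

/-! ### Graph minors and the Hadwiger number -/

/-- `H` is a minor of `G`: the vertices of `H` can be modelled by pairwise disjoint, nonempty,
connected sets of vertices of `G` (the sets that are contracted), with an edge of `G` between the
sets of any two vertices that are adjacent in `H`. -/
def IsGraphMinor {W V : Type*} (H : SimpleGraph W) (G : SimpleGraph V) : Prop :=
  ∃ B : W → Set V,
    (∀ w, (G.induce (B w)).Connected) ∧
    (∀ w w', w ≠ w' → Disjoint (B w) (B w')) ∧
    (∀ w w', H.Adj w w' → ∃ x ∈ B w, ∃ x' ∈ B w', G.Adj x x')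

/-- The Hadwiger number: the largest `k` such that the complete graph on `k` vertices is a
minor of `G`. -/
noncomputable def hadwigerNumber {V : Type*} (G : SimpleGraph V) : ℕ :=
  sSup {k : ℕ | IsGraphMinor (⊤ : SimpleGraph (Fin k)) G}

theorem le_card_of_isGraphMinor {W V : Type*} [Fintype W] [Fintype V] {H : SimpleGraph W}
    {G : SimpleGraph V} (h : IsGraphMinor H G) : Fintype.card W ≤ Fintype.card V := by
  obtain ⟨B, hc, hd, -⟩ := h
  have hne : ∀ w, ∃ x, x ∈ B w := fun w => by
    obtain ⟨x⟩ := (hc w).nonempty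
    exact ⟨x.1, x.2⟩
  choose f hf using hne
  refine Fintype.card_le_of_injective f fun w w' hww' => ?_
  by_contra hne
  exact Set.disjoint_left.mp (hd w w' hne) (hf w) (hww' ▸ hf w')

/-- The supremum in `hadwigerNumber` is a maximum. -/
theorem isGreatest_hadwigerNumber {V : Type*} [Fintype V] (G : SimpleGraph V) :
    IsGreatest {k : ℕ | IsGraphMinor (⊤ : SimpleGraph (Fin k)) G} (hadwigerNumber G) := by
  have hb : BddAbove {k : ℕ | IsGraphMinor (⊤ : SimpleGraph (Fin k)) G} :=
    ⟨Fintype.card V, fun k hk => by simpa using le_card_of_isGraphMinor hk⟩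
  refine ⟨Nat.sSup_mem ⟨0, fun _ => ∅, ?_, ?_, ?_⟩ hb, fun k hk => le_csSup hb hk⟩
  · exact fun w => w.elim0
  · exact fun w => w.elim0
  · exact fun w => w.elim0

/-! ### Geodesic convexity and near-convex labelings -/

/-- The geodesic interval `I(u, v)`: all vertices on some shortest path from `u` to `v`. -/
def geodesicInterval {V : Type*} (G : SimpleGraph V) (u v : V) : Set V :=
  {x | ∃ p : G.Walk u v, p.length = G.dist u v ∧ x ∈ p.support}

/-- A set of vertices is (geodesically) convex if it contains the interval between any two of
its members. -/
def IsGeodesicallyConvex {V : Type*} (G : SimpleGraph V) (C : Set V) : Prop :=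
  ∀ a ∈ C, ∀ b ∈ C, geodesicInterval G a b ⊆ C

/-- A binary labeling is convex if both of its clusters are convex. -/
def IsConvexLabeling {V : Type*} (G : SimpleGraph V) (y : V → Bool) : Prop :=
  ∀ i : Bool, IsGeodesicallyConvex G {v | y v = i}

/-- `y` can be converted into a convex labeling by flipping the labels of at most `M` nodes. -/
def IsNearConvex {V : Type*} [Fintype V] (G : SimpleGraph V) (y : V → Bool) (M : ℕ) : Prop :=
  ∃ z : V → Bool, IsConvexLabeling G z ∧ (Finset.univ.filter fun v => z v ≠ y v).card ≤ M

/-- The number `M*`: the smallest `M` such that `y` is `M`-near-convex. -/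
noncomputable def minFlips {V : Type*} [Fintype V] (G : SimpleGraph V) (y : V → Bool) : ℕ :=
  sInf {M : ℕ | IsNearConvex G y M}

/-- The infimum in `minFlips` is a minimum. -/
theorem isLeast_minFlips {V : Type*} [Fintype V] (G : SimpleGraph V) (y : V → Bool) :
    IsLeast {M : ℕ | IsNearConvex G y M} (minFlips G y) := by
  refine ⟨Nat.sInf_mem ⟨_, fun _ => true, fun i a ha b hb x hx => ?_, le_rfl⟩,
    fun M hM => Nat.sInf_le hM⟩
  exact ha

/-! ### Good quadruples -/

/-- The set `Q_good(U)` of good quadruples `{(a, b), (c, d)}` in `U`: unordered pairs of unordered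
pairs, with `a, b, c, d` four distinct nodes of `U` such that `I(a, b)` and `I(c, d)`
intersect. -/
def goodQuadruples {V : Type*} (G : SimpleGraph V) (U : Finset V) : Set (Sym2 (Sym2 V)) :=
  {q | ∃ a ∈ U, ∃ b ∈ U, ∃ c ∈ U, ∃ d ∈ U,
    [a, b, c, d].Nodup ∧ (geodesicInterval G a b ∩ geodesicInterval G c d).Nonempty ∧
    q = s(s(a, b), s(c, d))}

/-- The number of good quadruples in `U` in which `a` participates. -/
noncomputable def scoreA {V : Type*} (G : SimpleGraph V) (U : Finset V) (a : V) : ℕ :=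
  {q | q ∈ goodQuadruples G U ∧ ∃ p ∈ q, a ∈ p}.ncard

/-- The number of pairs `(c, d)` such that `{(a, b), (c, d)}` is a good quadruple in `U`. -/
noncomputable def scoreB {V : Type*} (G : SimpleGraph V) (U : Finset V) (a b : V) : ℕ :=
  {p : Sym2 V | s(s(a, b), p) ∈ goodQuadruples G U}.ncard

/-- The number of nodes `d` such that `{(a, b), (c, d)}` is a good quadruple in `U`. -/
noncomputable def scoreC {V : Type*} (G : SimpleGraph V) (U : Finset V) (a b c : V) : ℕ :=
  {d : V | s(s(a, b), s(c, d)) ∈ goodQuadruples G U}.ncard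

/-! ### Self-directed learning of a binary labeling -/

/-- One trial: the node selected by the learner, its prediction, and the true label revealed
afterwards. -/
structure Trial (V : Type*) where
  node : V
  guess : Bool
  label : Bool

/-- A self-directed learner: from the trials so far it determines the next node and the
prediction for its label. -/
abbrev Learner (V : Type*) := List (Trial V) → V × Bool

/-- The first `t` trials (in chronological order) of the learner `L` when the true labeling
is `y`. -/
def trials {V : Type*} (L : Learner V) (y : V → Bool) : ℕ → List (Trial V)
  | 0 => []
  | t + 1 =>
    trials L y t ++
      [⟨(L (trials L y t)).1, (L (trials L y t)).2, y (L (trials L y t)).1⟩]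

/-- The number of mistakes of `L` on the labeling `y` during the `n = |V|` trials. -/
def mistakes {V : Type*} [Fintype V] (L : Learner V) (y : V → Bool) : ℕ :=
  (trials L y (Fintype.card V)).countP fun τ => τ.guess != τ.label

/-! ### The algorithm Good4 -/

/-- The position of the program between two trials.
* `step1`: the main loop has just been entered.
* `step2 a l W`: looking for `b`; `l` is the observed label of `a`, and `W` is the value of the
  set of unlabeled nodes at the start of this step (when the scores are computed).
* `step3 a b l W`: looking for `c`, with `W` as before.
* `step4 a b c l`: iterating over the nodes `d`.
* `step5`: the main loop has been left. -/
inductive Good4Phase (V : Type*)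
  | step1
  | step2 (a : V) (l : Bool) (W : Finset V)
  | step3 (a b : V) (l : Bool) (W : Finset V)
  | step4 (a b c : V) (l : Bool)
  | step5

/-- A state of the algorithm: the set `U` of unlabeled nodes and the position of the program. -/
structure Good4State (V : Type*) where
  U : Finset V
  phase : Good4Phase V

open Classical in
/-- The head of the main loop: continue as long as there is a good quadruple in `U`. -/
noncomputable def good4Loop {V : Type*} (G : SimpleGraph V) (U : Finset V) : Good4State V :=
  if (goodQuadruples G U).Nonempty then ⟨U, .step1⟩ else ⟨U, .step5⟩

/-- The nodes over which Step 4 still has to iterate. -/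
def good4Sweep {V : Type*} [DecidableEq V] (G : SimpleGraph V) (U : Finset V) (a b c : V) :
    Set V :=
  {d | d ∈ U ∧ s(s(a, b), s(c, d)) ∈ goodQuadruples G (U ∪ {a, b, c})}

open Classical in
/-- Step 4, left as soon as there is no node to iterate over. -/
noncomputable def good4Step4 {V : Type*} [DecidableEq V] (G : SimpleGraph V) (U : Finset V)
    (a b c : V) (l : Bool) : Good4State V :=
  if (good4Sweep G U a b c).Nonempty then ⟨U, .step4 a b c l⟩ else good4Loop G U

/-- The trials (node `v`, prediction `p`) that the algorithm may perform in a given state. Ties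
in the maximizations, the order of iteration in Steps 4 and 5, and the arbitrary predictions of
Steps 1 and 5 are left open. -/
def Good4Allows {V : Type*} [DecidableEq V] (G : SimpleGraph V) (S : Good4State V)
    (v : V) (p : Bool) : Prop :=
  v ∈ S.U ∧
  match S.phase with
  | .step1 => ∀ a' ∈ S.U, scoreA G S.U a' ≤ scoreA G S.U v
  | .step2 a l W =>
      (∀ b' ∈ S.U, scoreB G (W ∪ {a}) a b' ≤ scoreB G (W ∪ {a}) a v) ∧ p = !l
  | .step3 a b l W =>
      (∀ c' ∈ S.U, scoreC G (W ∪ {a, b}) a b c' ≤ scoreC G (W ∪ {a, b}) a b v) ∧ p = l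
  | .step4 a b c l => v ∈ good4Sweep G S.U a b c ∧ p = l
  | .step5 => True

/-- The state after a trial. In Steps 2 and 3 the search goes on until a mistake is made (if `U`
becomes empty first, all nodes are labeled and the algorithm has ended); Step 4 is left
after a mistake or when there is no further `d`. -/
noncomputable def good4Next {V : Type*} [DecidableEq V] (G : SimpleGraph V) (S : Good4State V)
    (τ : Trial V) : Good4State V :=
  match S.phase with
  | .step1 => ⟨S.U.erase τ.node, .step2 τ.node τ.label (S.U.erase τ.node)⟩
  | .step2 a l W =>
      if τ.guess ≠ τ.label then
        ⟨S.U.erase τ.node, .step3 a τ.node l (S.U.erase τ.node)⟩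
      else ⟨S.U.erase τ.node, .step2 a l W⟩
  | .step3 a b l W =>
      if τ.guess ≠ τ.label then good4Step4 G (S.U.erase τ.node) a b τ.node l
      else ⟨S.U.erase τ.node, .step3 a b l W⟩
  | .step4 a b c l =>
      if τ.guess ≠ τ.label then good4Loop G (S.U.erase τ.node)
      else good4Step4 G (S.U.erase τ.node) a b c l
  | .step5 => ⟨S.U.erase τ.node, .step5⟩

/-- The state reached after a list of trials, starting with all nodes unlabeled. -/
noncomputable def good4State {V : Type*} [Fintype V] [DecidableEq V] (G : SimpleGraph V)
    (h : List (Trial V)) : Good4State V :=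
  h.foldl (good4Next G) (good4Loop G Finset.univ)

/-- `L` is an implementation of Good4 on the graph `G`: whatever the true labeling is, each of
its trials is one that the algorithm may perform. -/
def IsGood4 {V : Type*} [Fintype V] [DecidableEq V] (G : SimpleGraph V) (L : Learner V) : Prop :=
  ∀ y : V → Bool, ∀ t < Fintype.card V,
    Good4Allows G (good4State G (trials L y t)) (L (trials L y t)).1 (L (trials L y t)).2

/-! Write H = (h(G)+1)^4, and call a node exceptional if a nearest convex labeling flips it; there
are M* such nodes. If a, b carry one label, c, d the other, and I(a,b) meets I(c,d), then one of the
four is exceptional, since a common node of the intervals cannot lie in both convex clusters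
(`IsConvexLabeling.exists_flip`). A mistake in Step 4 exposes such a quadruple: an exceptional node
leaves U and pays for the at most four mistakes of the iteration.

An iteration whose Step 4 makes no mistake has at most three, charged to the nodes it labels. Good
quadruples are dense: any h(G)+1 nodes a_i and h(G)+1 nodes b_j contain a crosswise one, because
otherwise shortest paths taken in breadth-first trees rooted at the b_j would yield too large a
complete minor (`SimpleGraph.Connected.isGraphMinor_top_of_disjoint_treePath`). Averaging over maps
into U gives a lower bound of order |U|^4/H (`four_mul_card_pow_four_le`). As a, b, c are greedy
choices, few labeled nodes would mean few good quadruples; so an iteration that shrinks U from u to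
v nodes has u ≤ H(u - v) (`card_le_of_goodTripleCount_le`), and the potential, the sum of min(1,
3H/i) over i ≤ |U|, drops by at least 3 (`potential_add_three_le`).

When no good quadruple is left, |U| ≤ 3H and the potential equals |U|, one unit per remaining
mistake. Its initial value is at most 3H ln n (`potential_le_log`). `MistakeInvariant` carries this
accounting through every trial. -/

namespace SimpleGraph

/-! ### Geodesic intervals and breadth-first search trees -/

variable {V : Type*} {G : SimpleGraph V}

theorem geodesicInterval_comm (u v : V) : geodesicInterval G u v = geodesicInterval G v u := by
  have h : ∀ u v : V, geodesicInterval G u v ⊆ geodesicInterval G v u := by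
    rintro u v x ⟨p, hp, hx⟩
    exact ⟨p.reverse, by rw [Walk.length_reverse, hp, dist_comm], by simpa using hx⟩
  exact Set.Subset.antisymm (h u v) (h v u)

theorem Connected.mem_geodesicInterval (hG : G.Connected) {u v x : V}
    (h : G.dist u x + G.dist x v = G.dist u v) : x ∈ geodesicInterval G u v := by
  obtain ⟨p, hp⟩ := hG.exists_walk_length_eq_dist u x
  obtain ⟨q, hq⟩ := hG.exists_walk_length_eq_dist x v
  exact ⟨p.append q, by rw [Walk.length_append, hp, hq, h], by simp⟩

theorem Connected.exists_parent (hG : G.Connected) (r : V) :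
    ∃ f : V → V, f r = r ∧ ∀ x, x ≠ r → G.Adj x (f x) ∧ G.dist (f x) r + 1 = G.dist x r := by
  have h : ∀ x, ∃ z, (x = r → z = r) ∧
      (x ≠ r → G.Adj x z ∧ G.dist z r + 1 = G.dist x r) := by
    intro x
    by_cases hx : x = r
    · exact ⟨r, fun _ => rfl, fun h => absurd hx h⟩
    · obtain ⟨p, hp⟩ := hG.exists_walk_length_eq_dist x r
      cases p with
      | nil => exact absurd rfl hx
      | @cons _ z _ hxz q =>
        refine ⟨z, fun h => absurd h hx, fun _ => ⟨hxz, ?_⟩⟩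
        have h1 : G.dist z r ≤ q.length := dist_le q
        have h2 : G.dist x r ≤ G.dist x z + G.dist z r := hG.dist_triangle
        have h3 : G.dist x z = 1 := dist_eq_one_iff_adj.mpr hxz
        rw [Walk.length_cons] at hp
        omega
  choose f hf using h
  exact ⟨f, (hf r).1 rfl, fun x hx => (hf x).2 hx⟩

/-- A parent map of a breadth-first search tree rooted at `r`. -/
noncomputable def Connected.parent (hG : G.Connected) (r : V) : V → V :=
  (hG.exists_parent r).choose

theorem Connected.parent_root (hG : G.Connected) (r : V) : hG.parent r r = r :=
  (hG.exists_parent r).choose_spec.1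

theorem Connected.parent_spec (hG : G.Connected) {r x : V} (hx : x ≠ r) :
    G.Adj x (hG.parent r x) ∧ G.dist (hG.parent r x) r + 1 = G.dist x r :=
  (hG.exists_parent r).choose_spec.2 x hx

/-- The vertices on the path from `a` to `r` in the breadth-first search tree rooted at `r`. -/
def Connected.treePath (hG : G.Connected) (a r : V) : Set V :=
  {x | ∃ k, x = (hG.parent r)^[k] a}

theorem Connected.left_mem_treePath (hG : G.Connected) (a r : V) : a ∈ hG.treePath a r :=
  ⟨0, rfl⟩

/-- All paths to `r` follow the same parent map, so two that meet share the rest of the way to the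
root. Arbitrary shortest paths need not do this. -/
theorem Connected.iterate_parent_mem_treePath (hG : G.Connected) {a r x : V}
    (hx : x ∈ hG.treePath a r) (k : ℕ) : (hG.parent r)^[k] x ∈ hG.treePath a r := by
  obtain ⟨m, rfl⟩ := hx
  exact ⟨k + m, (Function.iterate_add_apply _ _ _ _).symm⟩

theorem Connected.dist_iterate_parent (hG : G.Connected) (a r : V) (k : ℕ) :
    G.dist ((hG.parent r)^[k] a) r = G.dist a r - k := by
  induction k with
  | zero => rfl
  | succ k ih =>
    rw [Function.iterate_succ_apply']
    by_cases hx : (hG.parent r)^[k] a = r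
    · rw [hx, dist_self] at ih
      rw [hx, hG.parent_root, dist_self]
      omega
    · have := (hG.parent_spec hx).2
      omega

theorem Connected.iterate_parent_dist (hG : G.Connected) (a r : V) :
    (hG.parent r)^[G.dist a r] a = r := by
  have := hG.dist_iterate_parent a r (G.dist a r)
  rwa [Nat.sub_self, hG.dist_eq_zero_iff] at this

theorem Connected.right_mem_treePath (hG : G.Connected) (a r : V) : r ∈ hG.treePath a r :=
  ⟨G.dist a r, (hG.iterate_parent_dist a r).symm⟩

theorem Connected.treePath_subset (hG : G.Connected) (a r : V) :
    hG.treePath a r ⊆ geodesicInterval G a r := by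
  rintro x ⟨k, rfl⟩
  apply hG.mem_geodesicInterval
  induction k with
  | zero => simp
  | succ k ih =>
    rw [Function.iterate_succ_apply']
    by_cases hx : (hG.parent r)^[k] a = r
    · rw [hx] at ih
      rwa [hx, hG.parent_root]
    · set x := (hG.parent r)^[k] a
      have h1 := hG.parent_spec hx
      have h2 : G.dist a (hG.parent r x) ≤ G.dist a x + G.dist x (hG.parent r x) :=
        hG.dist_triangle
      have h3 : G.dist a r ≤ G.dist a (hG.parent r x) + G.dist (hG.parent r x) r :=
        hG.dist_triangle
      have h4 : G.dist x (hG.parent r x) = 1 := dist_eq_one_iff_adj.mpr h1.1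
      omega

theorem Connected.adj_parent_of_ne (hG : G.Connected) {r x : V} (h : hG.parent r x ≠ x) :
    G.Adj x (hG.parent r x) := by
  refine (hG.parent_spec ?_).1
  rintro rfl
  exact h (hG.parent_root _)

/-- If all iterates of the parent map up to the `k`-th stay in `B`, then they are reachable
inside `B`. -/
theorem Connected.reachable_iterate_parent (hG : G.Connected) {r x : V} {B : Set V} (k : ℕ)
    (h : ∀ i ≤ k, (hG.parent r)^[i] x ∈ B) :
    (G.induce B).Reachable ⟨x, h 0 k.zero_le⟩ ⟨(hG.parent r)^[k] x, h k le_rfl⟩ := by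
  induction k with
  | zero => exact Reachable.refl _
  | succ k ih =>
    refine (ih fun i hi => h i (by omega)).trans ?_
    by_cases he : (hG.parent r)^[k + 1] x = (hG.parent r)^[k] x
    · simp only [he]
      exact Reachable.refl _
    · apply Adj.reachable
      simp only [comap_adj, Function.Embedding.subtype_apply]
      rw [Function.iterate_succ_apply'] at he ⊢
      exact hG.adj_parent_of_ne he

/-! ### Branch sets of a complete minor -/

section Owner

variable {ι : Type*} (Q : ι → ι → Set V)

/-- `x` is owned by `i` with respect to the sets `Q`: it lies only in sets of row `i`, or in at
least two sets of column `i`. -/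
def Owns (i : ι) (x : V) : Prop :=
  ((∃ j, x ∈ Q i j) ∧ ∀ l j, x ∈ Q l j → l = i) ∨ ∃ l l', l ≠ l' ∧ x ∈ Q l i ∧ x ∈ Q l' i

variable {Q} (hQ : ∀ i l j m, i ≠ l → j ≠ m → Disjoint (Q i j) (Q l m))
include hQ

/-- Two sets of one column lie in different rows, so the two clauses exclude each other. Two
distinct columns, each containing `x` twice, would supply sets differing in both row and column,
which are disjoint. -/
theorem Owns.unique {i m : ι} {x : V} (hi : Owns Q i x) (hm : Owns Q m x) : i = m := by
  rcases hi with ⟨⟨j, hj⟩, hi⟩ | ⟨l, l', hl, h1, h2⟩ <;>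
    rcases hm with ⟨⟨j', hj'⟩, hm⟩ | ⟨p, p', hp, h3, h4⟩
  · exact hm _ _ hj
  · exact absurd ((hi _ _ h3).trans (hi _ _ h4).symm) hp
  · exact absurd ((hm _ _ h1).trans (hm _ _ h2).symm) hl
  · by_contra him
    by_cases h : l = p
    · exact Set.disjoint_left.mp (hQ l' p i m (fun h' => hl (h.trans h'.symm)) him) h2 h3
    · exact Set.disjoint_left.mp (hQ l p i m h him) h1 h3

/-- A further set containing `x` outside row `i` must, by disjointness, lie in column `j`, which
then contains `x` twice. -/
theorem owns_or_owns {i j : ι} {x : V} (hx : x ∈ Q i j) : Owns Q i x ∨ Owns Q j x := by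
  by_cases h : ∀ l m, x ∈ Q l m → l = i
  · exact Or.inl (Or.inl ⟨⟨j, hx⟩, h⟩)
  · push Not at h
    obtain ⟨l, m, hlm, hl⟩ := h
    have : m = j := by
      by_contra hm
      exact Set.disjoint_left.mp (hQ l i m j hl hm) hlm hx
    subst this
    exact Or.inr (Or.inr ⟨l, i, hl, hlm, hx⟩)

theorem owns_of_mem_diag {i : ι} {x : V} (hx : x ∈ Q i i) : Owns Q i x :=
  (owns_or_owns hQ hx).elim id id

end Owner

/-- The branch set of `i` is what `i` owns; it contains the whole path from `a i` to `b i`. A node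
on two paths of column `i` is joined to `b i` by their common tail, and a node found only in row `i`
is joined to `a i` by a prefix. -/
theorem Connected.isGraphMinor_top_of_disjoint_treePath (hG : G.Connected) {ι : Type*}
    (a b : ι → V)
    (hQ : ∀ i l j m, i ≠ l → j ≠ m → Disjoint (hG.treePath (a i) (b j)) (hG.treePath (a l) (b m))) :
    IsGraphMinor (⊤ : SimpleGraph ι) G := by
  set Q : ι → ι → Set V := fun i j => hG.treePath (a i) (b j) with hQdef
  have hb : ∀ i, Owns Q i (b i) := fun i =>
    owns_of_mem_diag (Q := Q) hQ (hG.right_mem_treePath (a i) (b i))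
  have ha : ∀ i, Owns Q i (a i) := fun i =>
    owns_of_mem_diag (Q := Q) hQ (hG.left_mem_treePath (a i) (b i))
  have hab : ∀ i, (G.induce {x | Owns Q i x}).Reachable ⟨a i, ha i⟩ ⟨b i, hb i⟩ := by
    intro i
    have := hG.reachable_iterate_parent (r := b i) (x := a i) (B := {x | Owns Q i x})
      (G.dist (a i) (b i)) fun k _ => owns_of_mem_diag (Q := Q) hQ ⟨k, rfl⟩
    simpa only [hG.iterate_parent_dist] using this
  refine ⟨fun i => {x | Owns Q i x}, fun i => ?_, fun i j hij => ?_, fun i j hij => ?_⟩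
  · rw [connected_iff_exists_forall_reachable]
    refine ⟨⟨b i, hb i⟩, ?_⟩
    rintro ⟨x, hx⟩
    rcases id hx with ⟨⟨j, k, hk⟩, hrow⟩ | ⟨l, l', hl, h1, h2⟩
    -- A prefix node on two paths of column `j` would put `x` on both as well, although `x` lies in
    -- row `i` only.
    · have hown : ∀ s ≤ k, Owns Q i ((hG.parent (b j))^[s] (a i)) := by
        intro s hs
        have hmem : (hG.parent (b j))^[s] (a i) ∈ Q i j := ⟨s, rfl⟩
        have hxs : x = (hG.parent (b j))^[k - s] ((hG.parent (b j))^[s] (a i)) := by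
          rw [← Function.iterate_add_apply, Nat.sub_add_cancel hs, hk]
        rcases owns_or_owns hQ hmem with h | h
        · exact h
        · rcases h with ⟨-, h⟩ | ⟨l, l', hl, h1, h2⟩
          · obtain rfl := h _ _ hmem
            exact owns_of_mem_diag hQ hmem
          · have e1 := hrow l j (hxs ▸ hG.iterate_parent_mem_treePath h1 _)
            have e2 := hrow l' j (hxs ▸ hG.iterate_parent_mem_treePath h2 _)
            exact absurd (e1.trans e2.symm) hl
      have := hG.reachable_iterate_parent (B := {x | Owns Q i x}) k hown
      subst hk
      exact (hab i).symm.trans this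
    · have := hG.reachable_iterate_parent (r := b i) (x := x) (B := {x | Owns Q i x})
        (G.dist x (b i)) fun k _ => Or.inr ⟨l, l', hl, hG.iterate_parent_mem_treePath h1 k,
          hG.iterate_parent_mem_treePath h2 k⟩
      simp only [hG.iterate_parent_dist] at this
      exact this.symm
  · exact Set.disjoint_left.mpr fun x hi hj => hij (Owns.unique hQ hi hj)
  · have hij : i ≠ j := hij
    -- The first node on the way from `a i` to `b j` not owned by `i` is owned by `j`; the step into
    -- it is the required edge.
    have hex : ∃ k, ¬ Owns Q i ((hG.parent (b j))^[k] (a i)) := by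
      refine ⟨G.dist (a i) (b j), ?_⟩
      rw [hG.iterate_parent_dist]
      exact fun h => hij (Owns.unique hQ h (hb j))
    classical
    obtain ⟨k, hk⟩ : ∃ k, Nat.find hex = k + 1 := by
      refine Nat.exists_eq_succ_of_ne_zero fun h0 => ?_
      have := Nat.find_spec hex
      rw [h0] at this
      exact this (ha i)
    have h1 := Nat.find_spec hex
    have h2 : Owns Q i ((hG.parent (b j))^[k] (a i)) :=
      not_not.mp (Nat.find_min hex (show k < Nat.find hex by omega))
    rw [hk] at h1
    have h3 : Owns Q j ((hG.parent (b j))^[k + 1] (a i)) :=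
      (owns_or_owns hQ (show (hG.parent (b j))^[k + 1] (a i) ∈ Q i j from ⟨k + 1, rfl⟩)).resolve_left
        h1
    refine ⟨_, h2, _, h3, ?_⟩
    rw [Function.iterate_succ_apply'] at h1 ⊢
    exact hG.adj_parent_of_ne fun h => h1 (by rw [h]; exact h2)

/-- Among `h(G) + 1` nodes `a i` and as many nodes `b j` there are two intersecting intervals
`I(a i, b j)` and `I(a l, b m)`. -/
theorem Connected.exists_geodesicInterval_inter [Fintype V] (hG : G.Connected)
    (a b : Fin (hadwigerNumber G + 1) → V) :
    ∃ i l j m, i ≠ l ∧ j ≠ m ∧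
      (geodesicInterval G (a i) (b j) ∩ geodesicInterval G (a l) (b m)).Nonempty := by
  by_contra hcon
  have hminor := hG.isGraphMinor_top_of_disjoint_treePath a b fun i l j m hil hjm => by
    refine Set.disjoint_left.mpr fun x h1 h2 => hcon ⟨i, l, j, m, hil, hjm, x, ?_, ?_⟩
    · exact hG.treePath_subset _ _ h1
    · exact hG.treePath_subset _ _ h2
  have := (isGreatest_hadwigerNumber G).2 hminor
  omega

end SimpleGraph

/-- The ordered form of a good quadruple `{(a, b), (c, d)}`. -/
def IsGoodTuple {V : Type*} (G : SimpleGraph V) (a b c d : V) : Prop :=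
  [a, b, c, d].Nodup ∧ (geodesicInterval G a b ∩ geodesicInterval G c d).Nonempty

/-! ### Symmetries of good quadruples -/

namespace IsGoodTuple

variable {V : Type*} {G : SimpleGraph V} {a b c d : V}

theorem swap (h : IsGoodTuple G a b c d) : IsGoodTuple G c d a b := by
  refine ⟨?_, Set.inter_comm _ _ ▸ h.2⟩
  have := h.1
  simp only [List.nodup_cons, List.mem_cons, List.not_mem_nil] at this ⊢
  grind

theorem swap_left (h : IsGoodTuple G a b c d) : IsGoodTuple G b a c d := by
  refine ⟨?_, SimpleGraph.geodesicInterval_comm a b ▸ h.2⟩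
  have := h.1
  simp only [List.nodup_cons, List.mem_cons, List.not_mem_nil] at this ⊢
  grind

theorem swap_right (h : IsGoodTuple G a b c d) : IsGoodTuple G a b d c :=
  h.swap.swap_left.swap

end IsGoodTuple

/-! ### Counting maps into a finite set -/

section Averaging

theorem card_filter_piFinset_eq_on_le {ι V : Type*} [Fintype ι] [DecidableEq ι] [DecidableEq V]
    (U : Finset V) (P : Finset ι) (q : ι → V) :
    ((Fintype.piFinset fun _ : ι => U).filter fun φ => ∀ i ∈ P, φ i = q i).card ≤
      U.card ^ (Fintype.card ι - P.card) := by
  calc _ ≤ (Fintype.piFinset fun i : ι => if i ∈ P then {q i} else U).card := by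
        refine Finset.card_le_card fun φ hφ => ?_
        rw [Finset.mem_filter, Fintype.mem_piFinset] at hφ
        rw [Fintype.mem_piFinset]
        intro i
        split_ifs with hi
        · exact Finset.mem_singleton.mpr (hφ.2 i hi)
        · exact hφ.1 i
    _ = ∏ i : ι, if i ∈ P then 1 else U.card := by
        rw [Fintype.card_piFinset]
        exact Finset.prod_congr rfl fun i _ => by split_ifs <;> simp
    _ = U.card ^ (Fintype.card ι - P.card) := by
        rw [Finset.prod_ite, Finset.prod_const_one, one_mul, Finset.prod_const,
          ← Finset.card_compl]
        congr 2
        ext i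
        simp

theorem card_filter_piFinset_not_injective_le {ι V : Type*} [Fintype ι] [DecidableEq ι]
    [DecidableEq V] (U : Finset V) :
    ((Fintype.piFinset fun _ : ι => U).filter fun φ => ¬ Function.Injective φ).card ≤
      Fintype.card ι * (Fintype.card ι - 1) * U.card ^ (Fintype.card ι - 1) := by
  have hpair : ∀ p ∈ (Finset.univ : Finset ι).offDiag,
      ((Fintype.piFinset fun _ : ι => U).filter fun φ => φ p.1 = φ p.2).card ≤
        U.card ^ (Fintype.card ι - 1) := by
    rintro ⟨p, q⟩ hpq
    have hpq : p ≠ q := (Finset.mem_offDiag.mp hpq).2.2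
    have hK : 2 ≤ Fintype.card ι := by
      have := Finset.card_le_univ ({p, q} : Finset ι)
      rwa [Finset.card_pair hpq] at this
    have := Finset.card_le_mul_card_image_of_maps_to
      (s := (Fintype.piFinset fun _ : ι => U).filter fun φ => φ p = φ q) (t := U)
      (f := fun φ => φ p) (fun φ hφ => Fintype.mem_piFinset.mp (Finset.mem_filter.mp hφ).1 p)
      (U.card ^ (Fintype.card ι - 2)) fun v _ => by
        refine le_trans (Finset.card_le_card fun φ hφ => ?_)
          ((card_filter_piFinset_eq_on_le U {p, q} fun _ => v).trans_eq
            (by rw [Finset.card_pair hpq]))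
        simp only [Finset.mem_filter, Finset.mem_insert, Finset.mem_singleton] at hφ ⊢
        refine ⟨hφ.1.1, ?_⟩
        rintro i (rfl | rfl)
        · exact hφ.2
        · exact hφ.1.2.symm.trans hφ.2
    refine this.trans_eq ?_
    rw [← pow_succ]
    congr 1
    omega
  calc _ ≤ ((Finset.univ : Finset ι).offDiag.biUnion fun p =>
        (Fintype.piFinset fun _ : ι => U).filter fun φ => φ p.1 = φ p.2).card := by
        refine Finset.card_le_card fun φ hφ => ?_
        rw [Finset.mem_filter, Function.not_injective_iff] at hφ
        obtain ⟨hφ, i, j, hij, hne⟩ := hφ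
        rw [Finset.mem_biUnion]
        exact ⟨(i, j), by simpa using hne, Finset.mem_filter.mpr ⟨hφ, hij⟩⟩
    _ ≤ (Finset.univ : Finset ι).offDiag.card * U.card ^ (Fintype.card ι - 1) :=
        Finset.card_biUnion_le_card_mul _ _ _ hpair
    _ = _ := by
        rw [Finset.offDiag_card, Finset.card_univ, Nat.mul_sub, mul_one]

end Averaging

/-! ### Density of good quadruples -/

section Counting

variable {V : Type*} (G : SimpleGraph V)

open Classical in
/-- The number of ordered tuples `(a, b, c, d)` in `U` that form a good quadruple. -/
noncomputable def goodTupleCount (U : Finset V) : ℕ :=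
  ((U ×ˢ U ×ˢ U ×ˢ U).filter fun t => IsGoodTuple G t.1 t.2.1 t.2.2.1 t.2.2.2).card

open Classical in
theorem card_filter_piFinset_isGoodTuple_le {ι : Type*} [Fintype ι] [DecidableEq ι]
    (U : Finset V) {i j l m : ι} (h : [i, j, l, m].Nodup) :
    ((Fintype.piFinset fun _ : ι => U).filter
      fun φ => IsGoodTuple G (φ i) (φ j) (φ l) (φ m)).card ≤
      U.card ^ (Fintype.card ι - 4) * goodTupleCount G U := by
  refine Finset.card_le_mul_card_image_of_maps_to
    (f := fun φ : ι → V => (φ i, φ j, φ l, φ m)) (fun φ hφ => ?_) _ fun t _ => ?_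
  · rw [Finset.mem_filter, Fintype.mem_piFinset] at hφ
    simp only [Finset.mem_filter, Finset.mem_product]
    exact ⟨⟨hφ.1 i, hφ.1 j, hφ.1 l, hφ.1 m⟩, hφ.2⟩
  · have hcard : ({i, j, l, m} : Finset ι).card = 4 := by
      simpa using List.toFinset_card_of_nodup h
    have h' := h
    simp only [List.nodup_cons, List.mem_cons, List.not_mem_nil, not_or] at h'
    obtain ⟨⟨hij, hil, him, -⟩, ⟨hjl, hjm, -⟩, ⟨hlm, -⟩, -⟩ := h'
    refine le_trans (Finset.card_le_card fun φ hφ => ?_)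
      ((card_filter_piFinset_eq_on_le U {i, j, l, m} fun s =>
        if s = i then t.1 else if s = j then t.2.1 else if s = l then t.2.2.1 else
          t.2.2.2).trans_eq (by rw [hcard]))
    simp only [Finset.mem_filter] at hφ ⊢
    refine ⟨hφ.1.1, ?_⟩
    obtain ⟨-, rfl⟩ := hφ
    intro s hs
    simp only [Finset.mem_insert, Finset.mem_singleton] at hs
    rcases hs with rfl | rfl | rfl | rfl
    · simp
    · simp [Ne.symm hij]
    · simp [Ne.symm hil, Ne.symm hjl]
    · simp [Ne.symm him, Ne.symm hjm, Ne.symm hlm]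

/-- The index pattern of the quadruples that pair elements of `α` with elements of `β`. -/
def crossTuples (α β : Type*) [Fintype α] [Fintype β] [DecidableEq α] [DecidableEq β] :
    Finset ((α × α) × (β × β)) :=
  (Finset.univ : Finset α).offDiag ×ˢ (Finset.univ : Finset β).offDiag

variable {G}

theorem exists_crossTuple [Fintype V] (hG : G.Connected)
    (φ : Fin (hadwigerNumber G + 1) ⊕ Fin (hadwigerNumber G + 1) → V)
    (hφ : Function.Injective φ) :
    ∃ i l j m, i ≠ l ∧ j ≠ m ∧
      IsGoodTuple G (φ (Sum.inl i)) (φ (Sum.inr j)) (φ (Sum.inl l)) (φ (Sum.inr m)) := by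
  obtain ⟨i, l, j, m, hil, hjm, h⟩ := hG.exists_geodesicInterval_inter
    (fun i => φ (Sum.inl i)) fun j => φ (Sum.inr j)
  refine ⟨i, l, j, m, hil, hjm, ?_, h⟩
  simp [hφ.eq_iff, hil, hjm]

-- The spare index on the second side yields a second quadruple: drop an index used by the first and
-- apply `exists_crossTuple` again. Each of the two occurs in two orders. The resulting factor 4
-- absorbs the factor 3 in `card_le_of_goodTripleCount_le`.
open Classical in
theorem four_le_card_crossTuples [Fintype V] (hG : G.Connected)
    (φ : Fin (hadwigerNumber G + 1) ⊕ Fin (hadwigerNumber G + 1 + 1) → V)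
    (hφ : Function.Injective φ) :
    4 ≤ ((crossTuples (Fin (hadwigerNumber G + 1)) (Fin (hadwigerNumber G + 1 + 1))).filter
      fun t => IsGoodTuple G (φ (Sum.inl t.1.1)) (φ (Sum.inr t.2.1)) (φ (Sum.inl t.1.2))
        (φ (Sum.inr t.2.2))).card := by
  have key : ∀ p : Fin (hadwigerNumber G + 1 + 1), ∃ i l j m, i ≠ l ∧ j ≠ m ∧ j ≠ p ∧ m ≠ p ∧
      IsGoodTuple G (φ (Sum.inl i)) (φ (Sum.inr j)) (φ (Sum.inl l)) (φ (Sum.inr m)) := by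
    intro p
    obtain ⟨i, l, j, m, hil, hjm, h⟩ := exists_crossTuple hG
      (φ ∘ Sum.map id p.succAbove)
      (hφ.comp (Function.Injective.sumMap Function.injective_id Fin.succAbove_right_injective))
    exact ⟨i, l, p.succAbove j, p.succAbove m, hil,
      fun h => hjm (Fin.succAbove_right_injective h), Fin.succAbove_ne p j,
      Fin.succAbove_ne p m, h⟩
  obtain ⟨i, l, j, m, hil, hjm, -, -, h⟩ := key 0
  obtain ⟨i', l', j', m', hil', hjm', hj, hm, h'⟩ := key j
  have hcard : ({((i, l), (j, m)), ((l, i), (m, j)), ((i', l'), (j', m')), ((l', i'), (m', j'))} :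
      Finset ((Fin (hadwigerNumber G + 1) × Fin (hadwigerNumber G + 1)) ×
        (Fin (hadwigerNumber G + 1 + 1) × Fin (hadwigerNumber G + 1 + 1)))).card = 4 := by
    rw [Finset.card_insert_of_notMem, Finset.card_insert_of_notMem, Finset.card_insert_of_notMem,
      Finset.card_singleton]
    · simp [hil']
    · simp [hj.symm, hm.symm]
    · simp [hil, hj.symm, hm.symm]
  rw [← hcard]
  refine Finset.card_le_card fun t ht => ?_
  simp only [Finset.mem_insert, Finset.mem_singleton] at ht
  simp only [crossTuples, Finset.mem_filter, Finset.mem_product, Finset.mem_offDiag,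
    Finset.mem_univ, true_and]
  rcases ht with rfl | rfl | rfl | rfl
  · exact ⟨⟨hil, hjm⟩, h⟩
  · exact ⟨⟨hil.symm, hjm.symm⟩, h.swap⟩
  · exact ⟨⟨hil', hjm'⟩, h'⟩
  · exact ⟨⟨hil'.symm, hjm'.symm⟩, h'.swap⟩

open Classical in
/-- A lower bound for the number of ordered good quadruples in a set of nodes. -/
theorem four_mul_card_pow_four_le [Fintype V] (hG : G.Connected) (hh : 1 ≤ hadwigerNumber G)
    (U : Finset V) :
    4 * U.card ^ 4 ≤
      (hadwigerNumber G + 1) ^ 2 * hadwigerNumber G * (hadwigerNumber G + 2) *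
        goodTupleCount G U +
      4 * ((2 * hadwigerNumber G + 3) * (2 * hadwigerNumber G + 2)) * U.card ^ 3 := by
  set h := hadwigerNumber G with hdef
  set A := Fin (h + 1)
  set B := Fin (h + 1 + 1)
  set u := U.card with hu
  set F := Fintype.piFinset fun _ : A ⊕ B => U with hF
  have hK : Fintype.card (A ⊕ B) = 2 * h + 3 := by
    simp [A, B]; ring
  have hFc : F.card = u ^ (2 * h + 3) := by
    rw [hF, Fintype.card_piFinset, Finset.prod_const, Finset.card_univ, hK]
  have hinj : (F.filter fun φ => ¬ Function.Injective φ).card ≤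
      Fintype.card (A ⊕ B) * (Fintype.card (A ⊕ B) - 1) * u ^ (Fintype.card (A ⊕ B) - 1) := by
    convert card_filter_piFinset_not_injective_le (ι := A ⊕ B) U
  have hsplit := Finset.card_filter_add_card_filter_not (s := F) (Function.Injective)
  have hX : (crossTuples A B).card = (h + 1) ^ 2 * h * (h + 2) := by
    rw [crossTuples, Finset.card_product, Finset.offDiag_card, Finset.offDiag_card]
    simp only [Finset.card_univ, A, B, Fintype.card_fin]
    rw [← Nat.mul_sub_one, ← Nat.mul_sub_one, Nat.add_sub_cancel, Nat.add_sub_cancel]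
    ring
  -- Double counting of incidences between maps `φ` and index patterns that `φ` makes good.
  have hlow : 4 * (F.filter Function.Injective).card ≤ ∑ φ ∈ F,
      ((crossTuples A B).filter fun t => IsGoodTuple G (φ (Sum.inl t.1.1)) (φ (Sum.inr t.2.1))
        (φ (Sum.inl t.1.2)) (φ (Sum.inr t.2.2))).card := by
    calc _ = ∑ φ ∈ F.filter Function.Injective, 4 := by
          rw [Finset.sum_const, smul_eq_mul, mul_comm]
      _ ≤ ∑ φ ∈ F.filter Function.Injective, _ := Finset.sum_le_sum fun φ hφ =>
          four_le_card_crossTuples hG φ (Finset.mem_filter.mp hφ).2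
      _ ≤ _ := Finset.sum_le_sum_of_subset (Finset.filter_subset _ _)
  have hup : ∑ φ ∈ F, ((crossTuples A B).filter fun t => IsGoodTuple G (φ (Sum.inl t.1.1))
        (φ (Sum.inr t.2.1)) (φ (Sum.inl t.1.2)) (φ (Sum.inr t.2.2))).card ≤
      (h + 1) ^ 2 * h * (h + 2) * (u ^ (2 * h - 1) * goodTupleCount G U) := by
    simp only [Finset.card_filter]
    rw [Finset.sum_comm, ← hX, ← smul_eq_mul]
    refine Finset.sum_le_card_nsmul _ _ _ fun t ht => ?_
    rw [← Finset.card_filter]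
    simp only [crossTuples, Finset.mem_product, Finset.mem_offDiag, Finset.mem_univ,
      true_and] at ht
    refine (card_filter_piFinset_isGoodTuple_le G U ?_).trans_eq ?_
    · simp [ht.1, ht.2]
    · rw [hK, show 2 * h + 3 - 4 = 2 * h - 1 by omega]
  rw [hK] at hinj
  rcases Nat.eq_zero_or_pos u with h0 | hpos
  · simp [h0]
  · obtain ⟨s, hs⟩ : ∃ s, 2 * h = s + 1 := ⟨2 * h - 1, by omega⟩
    rw [show 2 * h - 1 = s by omega] at hup
    rw [show 2 * h + 3 - 1 = s + 3 by omega] at hinj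
    rw [show 2 * h + 3 = s + 4 by omega] at hFc hinj ⊢
    rw [show 2 * h + 2 = s + 3 by omega]
    refine Nat.le_of_mul_le_mul_left ?_ (pow_pos hpos s)
    have e1 : u ^ s * (4 * u ^ 4) = 4 * u ^ (s + 4) := by ring
    have e2 : u ^ s * ((h + 1) ^ 2 * h * (h + 2) * goodTupleCount G U +
        4 * ((s + 4) * (s + 3)) * u ^ 3) =
        (h + 1) ^ 2 * h * (h + 2) * (u ^ s * goodTupleCount G U) +
        4 * ((s + 4) * (s + 3) * u ^ (s + 3)) := by ring
    rw [e1, e2]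
    omega

end Counting

/-! ### Scores and greedy choices -/

section Scores

variable {V : Type*} {G : SimpleGraph V}

theorem mem_goodQuadruples_iff {U : Finset V} {a b c d : V} :
    s(s(a, b), s(c, d)) ∈ goodQuadruples G U ↔
      (a ∈ U ∧ b ∈ U ∧ c ∈ U ∧ d ∈ U) ∧ IsGoodTuple G a b c d := by
  constructor
  · rintro ⟨a', ha, b', hb, c', hc, d', hd, h1, h2, h3⟩
    have h : IsGoodTuple G a' b' c' d' := ⟨h1, h2⟩
    rw [Sym2.eq_iff, Sym2.eq_iff, Sym2.eq_iff, Sym2.eq_iff, Sym2.eq_iff] at h3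
    obtain ⟨⟨rfl, rfl⟩ | ⟨rfl, rfl⟩, ⟨rfl, rfl⟩ | ⟨rfl, rfl⟩⟩ |
      ⟨⟨rfl, rfl⟩ | ⟨rfl, rfl⟩, ⟨rfl, rfl⟩ | ⟨rfl, rfl⟩⟩ := h3
    · exact ⟨⟨ha, hb, hc, hd⟩, h⟩
    · exact ⟨⟨ha, hb, hd, hc⟩, h.swap_right⟩
    · exact ⟨⟨hb, ha, hc, hd⟩, h.swap_left⟩
    · exact ⟨⟨hb, ha, hd, hc⟩, h.swap_left.swap_right⟩
    · exact ⟨⟨hc, hd, ha, hb⟩, h.swap⟩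
    · exact ⟨⟨hc, hd, hb, ha⟩, h.swap.swap_right⟩
    · exact ⟨⟨hd, hc, ha, hb⟩, h.swap.swap_left⟩
    · exact ⟨⟨hd, hc, hb, ha⟩, h.swap.swap_left.swap_right⟩
  · rintro ⟨⟨ha, hb, hc, hd⟩, h1, h2⟩
    exact ⟨a, ha, b, hb, c, hc, d, hd, h1, h2, rfl⟩

theorem IsGoodTuple.ne {a b c d : V} (h : IsGoodTuple G a b c d) :
    a ≠ b ∧ a ≠ c ∧ a ≠ d ∧ b ≠ c ∧ b ≠ d ∧ c ≠ d := by
  have := h.1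
  simp only [List.nodup_cons, List.mem_cons, List.not_mem_nil] at this
  grind

theorem card_eq_two_mul_card_image {α β : Type*} [DecidableEq α] [DecidableEq β] (s : Finset α)
    (f : α → β) (h : ∀ x ∈ s, (s.filter fun y => f y = f x).card = 2) :
    s.card = 2 * (s.image f).card := by
  rw [Finset.card_eq_sum_card_image f s, Finset.sum_const_nat (m := 2), mul_comm]
  intro y hy
  obtain ⟨x, hx, rfl⟩ := Finset.mem_image.mp hy
  exact h x hx

variable (G)

open Classical in
/-- The number of pairs `(c, d)` in `U` such that `(a, b, c, d)` is good. -/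
noncomputable def goodPairCount (U : Finset V) (a b : V) : ℕ :=
  ((U ×ˢ U).filter fun t => IsGoodTuple G a b t.1 t.2).card

open Classical in
/-- The number of triples `(b, c, d)` in `U` such that `(a, b, c, d)` is good. -/
noncomputable def goodTripleCount (U : Finset V) (a : V) : ℕ :=
  ((U ×ˢ U ×ˢ U).filter fun t => IsGoodTuple G a t.1 t.2.1 t.2.2).card

theorem goodTupleCount_eq_sum (U : Finset V) :
    goodTupleCount G U = ∑ a ∈ U, goodTripleCount G U a := by
  classical
  simp only [goodTupleCount, goodTripleCount, Finset.card_filter, Finset.sum_product]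

theorem goodTripleCount_eq_sum (U : Finset V) (a : V) :
    goodTripleCount G U a = ∑ b ∈ U, goodPairCount G U a b := by
  classical
  simp only [goodTripleCount, goodPairCount, Finset.card_filter, Finset.sum_product]

theorem goodPairCount_le (U : Finset V) (a b : V) : goodPairCount G U a b ≤ U.card ^ 2 := by
  classical
  refine (Finset.card_filter_le _ _).trans_eq ?_
  rw [Finset.card_product, sq]

variable {G}

open Classical in
theorem scoreC_eq {U : Finset V} {a b c : V} (ha : a ∈ U) (hb : b ∈ U) (hc : c ∈ U) :
    scoreC G U a b c = (U.filter fun d => IsGoodTuple G a b c d).card := by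
  rw [scoreC, ← Set.ncard_coe_finset]
  congr 1
  ext d
  simp [mem_goodQuadruples_iff, ha, hb, hc]

/-- Ordered counts are convenient to sum, while the scores are unordered; the constant factor
transfers maximality between them. -/
theorem goodPairCount_eq {U : Finset V} {a b : V} (ha : a ∈ U) (hb : b ∈ U) :
    goodPairCount G U a b = 2 * scoreB G U a b := by
  classical
  rw [goodPairCount, card_eq_two_mul_card_image _ fun t : V × V => s(t.1, t.2)]
  · rw [scoreB, ← Set.ncard_coe_finset]
    congr 2
    ext p
    induction p with | _ c d
    simp only [Finset.coe_image, Set.mem_image, Finset.mem_coe, Finset.mem_filter,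
      Finset.mem_product, Prod.exists, Set.mem_ofPred_eq, mem_goodQuadruples_iff]
    constructor
    · rintro ⟨c', d', ⟨⟨hc, hd⟩, h⟩, he⟩
      rcases Sym2.eq_iff.mp he with ⟨rfl, rfl⟩ | ⟨rfl, rfl⟩
      · exact ⟨⟨ha, hb, hc, hd⟩, h⟩
      · exact ⟨⟨ha, hb, hd, hc⟩, h.swap_right⟩
    · rintro ⟨⟨-, -, hc, hd⟩, h⟩
      exact ⟨c, d, ⟨⟨hc, hd⟩, h⟩, rfl⟩
  · rintro ⟨c, d⟩ ht
    simp only [Finset.mem_filter, Finset.mem_product] at ht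
    have hne : (c, d) ≠ (d, c) := fun h => ht.2.ne.2.2.2.2.2 (Prod.ext_iff.mp h).1
    rw [← Finset.card_pair hne]
    congr 1
    ext ⟨c', d'⟩
    simp only [Finset.mem_filter, Finset.mem_product, Finset.mem_insert, Finset.mem_singleton,
      Prod.mk.injEq, Sym2.eq_iff]
    constructor
    · exact fun h => h.2
    · rintro (⟨rfl, rfl⟩ | ⟨rfl, rfl⟩)
      · exact ⟨ht, by simp⟩
      · exact ⟨⟨ht.1.symm, ht.2.swap_right⟩, by simp⟩

theorem goodTripleCount_eq {U : Finset V} {a : V} (ha : a ∈ U) :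
    goodTripleCount G U a = 2 * scoreA G U a := by
  classical
  rw [goodTripleCount, card_eq_two_mul_card_image _
    fun t : V × V × V => s(s(a, t.1), s(t.2.1, t.2.2))]
  · rw [scoreA, ← Set.ncard_coe_finset]
    congr 2
    ext q
    simp only [Finset.coe_image, Set.mem_image, Finset.mem_coe, Finset.mem_filter,
      Finset.mem_product, Prod.exists, Set.mem_ofPred_eq]
    constructor
    · rintro ⟨b, c, d, ⟨⟨hb, hc, hd⟩, h⟩, rfl⟩
      exact ⟨mem_goodQuadruples_iff.mpr ⟨⟨ha, hb, hc, hd⟩, h⟩, s(a, b), by simp, by simp⟩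
    · rintro ⟨⟨a', ha', b, hb, c, hc, d, hd, h1, h2, rfl⟩, p, hp, hap⟩
      have h : IsGoodTuple G a' b c d := ⟨h1, h2⟩
      rcases Sym2.mem_iff.mp hp with rfl | rfl <;> rcases Sym2.mem_iff.mp hap with rfl | rfl
      · exact ⟨b, c, d, ⟨⟨hb, hc, hd⟩, h⟩, rfl⟩
      · exact ⟨a', c, d, ⟨⟨ha', hc, hd⟩, h.swap_left⟩, by rw [Sym2.eq_swap (a := a)]⟩
      · exact ⟨d, a', b, ⟨⟨hd, ha', hb⟩, h.swap⟩, by rw [Sym2.eq_swap]⟩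
      · exact ⟨c, a', b, ⟨⟨hc, ha', hb⟩, h.swap.swap_left⟩,
          by rw [Sym2.eq_swap, Sym2.eq_swap (a := a)]⟩
  · rintro ⟨b, c, d⟩ ht
    simp only [Finset.mem_filter, Finset.mem_product] at ht
    have hne' := ht.2.ne
    have hne : (b, c, d) ≠ (b, d, c) := fun h => hne'.2.2.2.2.2 (by simp at h; exact h.1)
    rw [← Finset.card_pair hne]
    congr 1
    ext ⟨b', c', d'⟩
    simp only [Finset.mem_filter, Finset.mem_product, Finset.mem_insert, Finset.mem_singleton,
      Prod.mk.injEq, Sym2.eq_iff]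
    constructor
    · grind
    · rintro (⟨rfl, rfl, rfl⟩ | ⟨rfl, rfl, rfl⟩)
      · exact ⟨ht, by simp⟩
      · exact ⟨⟨⟨ht.1.1, ht.1.2.symm⟩, ht.2.swap_right⟩, by simp⟩

theorem goodTupleCount_eq_zero {U : Finset V} (h : ¬ (goodQuadruples G U).Nonempty) :
    goodTupleCount G U = 0 := by
  classical
  rw [goodTupleCount, Finset.card_eq_zero, Finset.filter_eq_empty_iff]
  rintro ⟨a, b, c, d⟩ ht hgood
  simp only [Finset.mem_product] at ht
  exact h ⟨_, mem_goodQuadruples_iff.mpr ⟨ht, hgood⟩⟩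

theorem goodTupleCount_le_of_max {U : Finset V} {a : V} (ha : a ∈ U)
    (hmax : ∀ a' ∈ U, scoreA G U a' ≤ scoreA G U a) :
    goodTupleCount G U ≤ U.card * goodTripleCount G U a := by
  rw [goodTupleCount_eq_sum, ← smul_eq_mul]
  refine Finset.sum_le_card_nsmul _ _ _ fun a' ha' => ?_
  rw [goodTripleCount_eq ha, goodTripleCount_eq ha']
  exact Nat.mul_le_mul_left 2 (hmax a' ha')

/-- `X` stands for the nodes labeled before `b` in Step 2. They get the trivial bound; every other
node contributes at most as much as `b`. -/
theorem goodTripleCount_le_of_max [DecidableEq V] {U X : Finset V} {a b : V} (ha : a ∈ U)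
    (hb : b ∈ U)
    (hmax : ∀ b' ∈ U, b' ≠ a → b' ∉ X → scoreB G U a b' ≤ scoreB G U a b) :
    goodTripleCount G U a ≤ X.card * U.card ^ 2 + U.card * goodPairCount G U a b := by
  rw [goodTripleCount_eq_sum, ← Finset.sum_filter_add_sum_filter_not U (· ∈ X)]
  refine add_le_add ?_ ?_
  · refine (Finset.sum_le_card_nsmul _ _ _ fun b' _ => goodPairCount_le G U a b').trans ?_
    rw [smul_eq_mul]
    refine Nat.mul_le_mul_right _ (Finset.card_le_card fun v hv => ?_)
    exact (Finset.mem_filter.mp hv).2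
  · refine (Finset.sum_le_card_nsmul _ _ (goodPairCount G U a b) fun b' hb' => ?_).trans ?_
    · rw [Finset.mem_filter] at hb'
      by_cases h : b' = a
      · subst h
        classical
        rw [goodPairCount, Finset.card_eq_zero.mpr]
        · exact Nat.zero_le _
        · rw [Finset.filter_eq_empty_iff]
          exact fun t _ ht => ht.ne.1 rfl
      · rw [goodPairCount_eq ha hb, goodPairCount_eq ha hb'.1]
        exact Nat.mul_le_mul_left 2 (hmax b' hb'.1 h hb'.2)
    · rw [smul_eq_mul]
      exact Nat.mul_le_mul_right _ (Finset.card_filter_le _ _)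

-- `X` and `Y` stand for the nodes labeled before the mistakes on `b` and `c` in Steps 2 and 3.
-- Pairs touching `X` number at most 2|X||U|, those with first entry in `Y` at most |Y||U|; any
-- other first entry in `W` has at most as many partners in `W` as `c`.
open Classical in
theorem goodPairCount_le_of_max [DecidableEq V] {U X W Y : Finset V} {a b c : V}
    (hU : ∀ v ∈ U, v = a ∨ v = b ∨ v ∈ X ∨ v ∈ W) (hWU : W ⊆ U) (hc : c ∈ W)
    (hmax : ∀ c' ∈ W, c' ∉ Y → scoreC G (W ∪ {a, b}) a b c' ≤ scoreC G (W ∪ {a, b}) a b c) :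
    goodPairCount G U a b ≤ U.card * (2 * X.card + Y.card +
      (W.filter fun d => IsGoodTuple G a b c d).card) := by
  have hscore : ∀ c' ∈ W, scoreC G (W ∪ {a, b}) a b c' =
      (W.filter fun d => IsGoodTuple G a b c' d).card := by
    intro c' hc'
    rw [scoreC_eq (by simp) (by simp) (by simp [hc'])]
    congr 1
    ext d
    simp only [Finset.mem_filter, Finset.mem_union, Finset.mem_insert, Finset.mem_singleton]
    constructor
    · rintro ⟨hd, h⟩
      have := h.ne
      exact ⟨by tauto, h⟩
    · exact fun h => ⟨Or.inl h.1, h.2⟩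
  have hW : ((W ×ˢ W).filter fun t => IsGoodTuple G a b t.1 t.2).card ≤
      U.card * Y.card + U.card * (W.filter fun d => IsGoodTuple G a b c d).card := by
    have : ((W ×ˢ W).filter fun t => IsGoodTuple G a b t.1 t.2).card =
        ∑ c' ∈ W, (W.filter fun d => IsGoodTuple G a b c' d).card := by
      simp only [Finset.card_filter, Finset.sum_product]
    rw [this, ← Finset.sum_filter_add_sum_filter_not W (· ∈ Y)]
    refine add_le_add ?_ ?_
    · refine (Finset.sum_le_card_nsmul _ _ U.card fun c' _ =>
        (Finset.card_filter_le _ _).trans (Finset.card_le_card hWU)).trans ?_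
      rw [smul_eq_mul, mul_comm]
      refine Nat.mul_le_mul_left _ (Finset.card_le_card fun v hv => ?_)
      exact (Finset.mem_filter.mp hv).2
    · refine (Finset.sum_le_card_nsmul _ _ (W.filter fun d => IsGoodTuple G a b c d).card
        fun c' hc' => ?_).trans ?_
      · rw [Finset.mem_filter] at hc'
        rw [← hscore c' hc'.1, ← hscore c hc]
        exact hmax c' hc'.1 hc'.2
      · rw [smul_eq_mul]
        exact Nat.mul_le_mul_right _ ((Finset.card_filter_le _ _).trans (Finset.card_le_card hWU))
  calc goodPairCount G U a b
      ≤ (((X ×ˢ U) ∪ (U ×ˢ X)) ∪ (W ×ˢ W).filter fun t => IsGoodTuple G a b t.1 t.2).card := by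
        refine Finset.card_le_card fun t ht => ?_
        simp only [Finset.mem_filter, Finset.mem_product, Finset.mem_union] at ht ⊢
        have hne := ht.2.ne
        have h1 := hU _ ht.1.1
        have h2 := hU _ ht.1.2
        have := ht.1
        have := ht.2
        rcases h1 with h1 | h1 | h1 | h1 <;> rcases h2 with h2 | h2 | h2 | h2 <;>
          first
            | (exfalso; tauto)
            | tauto
    _ ≤ X.card * U.card + U.card * X.card + (U.card * Y.card +
          U.card * (W.filter fun d => IsGoodTuple G a b c d).card) := by
        refine (Finset.card_union_le _ _).trans (add_le_add ?_ hW)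
        refine (Finset.card_union_le _ _).trans_eq ?_
        rw [Finset.card_product, Finset.card_product]
    _ = _ := by ring

/-- If the triples through a node `a` of maximal score are controlled by a set of `r` nodes, then
`r + 3` is at least a fixed fraction of the number of nodes. -/
theorem card_le_of_goodTripleCount_le [Fintype V] (hG : G.Connected)
    (hh : 1 ≤ hadwigerNumber G) {U : Finset V} {a : V} (ha : a ∈ U)
    (hmax : ∀ a' ∈ U, scoreA G U a' ≤ scoreA G U a) {r : ℕ}
    (hr : goodTripleCount G U a ≤ 3 * U.card ^ 2 * r) :
    U.card ≤ (hadwigerNumber G + 1) ^ 4 * (r + 3) := by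
  have h1 := four_mul_card_pow_four_le hG hh U
  have h2 := goodTupleCount_le_of_max ha hmax
  have hpos : 0 < U.card := Finset.card_pos.mpr ⟨a, ha⟩
  set h := hadwigerNumber G
  set u := U.card
  have h3 : goodTupleCount G U ≤ u ^ 3 * (3 * r) :=
    h2.trans ((Nat.mul_le_mul_left u hr).trans_eq (by ring))
  have h4 : u ^ 3 * (4 * u) ≤ u ^ 3 * ((h + 1) ^ 2 * h * (h + 2) * (3 * r) +
      4 * ((2 * h + 3) * (2 * h + 2))) := by
    have := Nat.mul_le_mul_left ((h + 1) ^ 2 * h * (h + 2)) h3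
    nlinarith
  have h5 := Nat.le_of_mul_le_mul_left h4 (pow_pos hpos 3)
  have h6 : (h + 1) ^ 2 * h * (h + 2) ≤ (h + 1) ^ 4 :=
    calc (h + 1) ^ 2 * h * (h + 2) ≤ (h + 1) ^ 2 * (h * (h + 2) + 1) := by
          rw [mul_assoc]
          exact Nat.mul_le_mul_left _ (Nat.le_succ _)
      _ = _ := by ring
  -- This fails for h = 0.
  have h7 : (2 * h + 3) * (2 * h + 2) ≤ 3 * (h + 1) ^ 4 := by
    obtain ⟨k, hk⟩ : ∃ k, h = k + 1 := ⟨h - 1, by omega⟩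
    rw [hk]
    ring_nf
    nlinarith [sq_nonneg k, Nat.zero_le (k ^ 3), Nat.zero_le (k ^ 4)]
  -- With H = (h+1)^4, `h5` becomes 4u ≤ 3Hr + 12H, which is at most 4H(r+3).
  have h8 := Nat.mul_le_mul_right (3 * r) h6
  nlinarith

theorem card_le_of_goodQuadruples_empty [Fintype V] (hG : G.Connected)
    (hh : 1 ≤ hadwigerNumber G) {U : Finset V} (hU : ¬ (goodQuadruples G U).Nonempty) :
    U.card ≤ 3 * (hadwigerNumber G + 1) ^ 4 := by
  have h1 := four_mul_card_pow_four_le hG hh U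
  rw [goodTupleCount_eq_zero hU, mul_zero, zero_add] at h1
  rcases Nat.eq_zero_or_pos U.card with h0 | hpos
  · omega
  set h := hadwigerNumber G
  set u := U.card
  have h5 : u ≤ (2 * h + 3) * (2 * h + 2) := by
    refine Nat.le_of_mul_le_mul_left ?_ (show 0 < 4 * u ^ 3 by positivity)
    linarith [show 4 * u ^ 4 = 4 * u ^ 3 * u by ring, show 4 * ((2 * h + 3) * (2 * h + 2)) * u ^ 3 =
      4 * u ^ 3 * ((2 * h + 3) * (2 * h + 2)) by ring]
  refine h5.trans ?_
  obtain ⟨k, hk⟩ : ∃ k, h = k + 1 := ⟨h - 1, by omega⟩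
  rw [hk]
  ring_nf
  nlinarith [sq_nonneg k, Nat.zero_le (k ^ 3), Nat.zero_le (k ^ 4)]

end Scores

/-! ### The potential function -/

section Potential

/-- A concave potential with `potential H u = u` for `u ≤ 3 * H` and logarithmic growth
afterwards. -/
noncomputable def potential (H u : ℕ) : ℝ :=
  ∑ i ∈ Finset.range u, min 1 (3 * (H : ℝ) / ((i : ℝ) + 1))

theorem potential_succ (H u : ℕ) :
    potential H (u + 1) = potential H u + min 1 (3 * (H : ℝ) / ((u : ℝ) + 1)) :=
  Finset.sum_range_succ _ _

theorem potential_mono (H : ℕ) : Monotone (potential H) := by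
  refine monotone_nat_of_le_succ fun u => ?_
  rw [potential_succ]
  have : (0 : ℝ) ≤ min 1 (3 * (H : ℝ) / ((u : ℝ) + 1)) := by positivity
  linarith

theorem potential_eq_of_le {H u : ℕ} (h : u ≤ 3 * H) : potential H u = u := by
  have : ∀ i ∈ Finset.range u, min 1 (3 * (H : ℝ) / ((i : ℝ) + 1)) = 1 := by
    intro i hi
    have hi : i + 1 ≤ 3 * H := by
      have := Finset.mem_range.mp hi
      omega
    refine min_eq_left ?_
    rw [le_div_iff₀ (by positivity), one_mul]
    exact_mod_cast hi
  rw [potential, Finset.sum_congr rfl this]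
  simp

/-- Each of the u - v lost terms is at least min(1, 3H/u), and their number is at least both 3 and
u/H. -/
theorem potential_add_three_le {H u v : ℕ} (h3 : v + 3 ≤ u) (h : u ≤ H * (u - v)) :
    potential H v + 3 ≤ potential H u := by
  have hupos : (0 : ℝ) < u := by exact_mod_cast (show 0 < u by omega)
  have hsum : potential H u = potential H v +
      ∑ i ∈ Finset.Ico v u, min 1 (3 * (H : ℝ) / ((i : ℝ) + 1)) := by
    rw [potential, potential, Finset.sum_range_add_sum_Ico _ (by omega)]
  have hle : ∑ i ∈ Finset.Ico v u, min 1 (3 * (H : ℝ) / (u : ℝ)) ≤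
      ∑ i ∈ Finset.Ico v u, min 1 (3 * (H : ℝ) / ((i : ℝ) + 1)) := by
    refine Finset.sum_le_sum fun i hi => min_le_min le_rfl ?_
    have : (i : ℝ) + 1 ≤ u := by exact_mod_cast (Finset.mem_Ico.mp hi).2
    gcongr
  rw [Finset.sum_const, Nat.card_Ico, nsmul_eq_mul] at hle
  have h3' : (3 : ℝ) ≤ ((u - v : ℕ) : ℝ) := by exact_mod_cast (show 3 ≤ u - v by omega)
  have h' : (u : ℝ) ≤ H * ((u - v : ℕ) : ℝ) := by exact_mod_cast h
  have : (3 : ℝ) ≤ ((u - v : ℕ) : ℝ) * min 1 (3 * (H : ℝ) / (u : ℝ)) := by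
    rcases min_cases (1 : ℝ) (3 * (H : ℝ) / (u : ℝ)) with ⟨h1, -⟩ | ⟨h1, -⟩
    · rw [h1]
      linarith
    · rw [h1, mul_div_assoc', le_div_iff₀ hupos]
      linarith
  linarith

/-- The increments compare by 1/(u+1) ≤ ln(u+1) - ln u. The induction can start at 2 because 3 ln 2
> 2; at u = 1 the bound fails. -/
theorem potential_le_log {H u : ℕ} (hH : 1 ≤ H) (hu : 2 ≤ u) :
    potential H u ≤ 3 * (H : ℝ) * Real.log u := by
  have hH' : (1 : ℝ) ≤ H := by exact_mod_cast hH
  induction u, hu using Nat.le_induction with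
  | base =>
    rw [potential_eq_of_le (by omega)]
    have := Real.log_two_gt_d9
    push_cast
    nlinarith
  | succ u hu ih =>
    have hu0 : (0 : ℝ) < u := by exact_mod_cast (show 0 < u by omega)
    have hlog : 1 / ((u : ℝ) + 1) ≤ Real.log (u + 1) - Real.log u := by
      have := Real.one_sub_inv_le_log_of_pos (show 0 < ((u : ℝ) + 1) / u by positivity)
      rw [Real.log_div (by positivity) hu0.ne'] at this
      refine le_trans (le_of_eq ?_) this
      field_simp
      ring
    have h1 : min 1 (3 * (H : ℝ) / ((u : ℝ) + 1)) ≤ 3 * (H : ℝ) * (1 / ((u : ℝ) + 1)) :=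
      (min_le_right _ _).trans_eq (by ring)
    have h2 := mul_le_mul_of_nonneg_left hlog (show 0 ≤ 3 * (H : ℝ) by positivity)
    rw [potential_succ]
    push_cast
    linarith

end Potential

/-! ### The mistake invariant, phase by phase -/

section Invariant

variable {V : Type*} [Fintype V] [DecidableEq V] (G : SimpleGraph V) (y : V → Bool) (F : Finset V)

/-- The number of mistakes that is accounted for when the main loop is at the set `U`: four for
each exceptional node outside `U`, and the loss of potential. -/
noncomputable def budget (U : Finset V) : ℝ :=
  4 * ((F \ U).card : ℝ) + potential ((hadwigerNumber G + 1) ^ 4) (Fintype.card V) -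
    potential ((hadwigerNumber G + 1) ^ 4) U.card

open Classical in
/-- What holds in Step 4 of an iteration that started with the set `U₀`. -/
structure SweepInvariant (U₀ U : Finset V) (a b c : V) (l : Bool) (m : ℕ) : Prop where
  ha : a ∈ U₀
  hb : b ∈ U₀
  hc : c ∈ U₀
  hab : a ≠ b
  hac : a ≠ c
  hbc : b ≠ c
  hU : U ⊆ U₀
  haU : a ∉ U
  hbU : b ∉ U
  hcU : c ∉ U
  hya : y a = l
  hyb : y b = l
  hyc : y c ≠ l
  hmax : ∀ a' ∈ U₀, scoreA G U₀ a' ≤ scoreA G U₀ a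
  -- The counted nodes are those already labeled in this iteration, apart from `a`, `b`, `c`, and
  -- those Step 4 still has to visit.
  hcount : goodTripleCount G U₀ a ≤ 3 * U₀.card ^ 2 *
    ((U₀ \ {a, b, c}).filter fun v => v ∉ U ∨ IsGoodTuple G a b c v).card
  hm : (m : ℝ) ≤ budget G F U₀ + 3

/-- The relation between the state of the algorithm and the number `m` of mistakes so far. -/
def MistakeInvariant (S : Good4State V) (m : ℕ) : Prop :=
  match S.phase with
  | .step1 => (m : ℝ) ≤ budget G F S.U
  | .step2 a l W => a ∉ W ∧ S.U ⊆ W ∧ y a = l ∧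
      (∀ a' ∈ W ∪ {a}, scoreA G (W ∪ {a}) a' ≤ scoreA G (W ∪ {a}) a) ∧
      (m : ℝ) ≤ budget G F (W ∪ {a}) + 1
  -- `U₀` is the unlabeled set at the start of the iteration, `X` the set of nodes predicted
  -- correctly in Step 2.
  | .step3 a b l W => ∃ U₀ X : Finset V, a ∈ U₀ ∧ b ∈ U₀ ∧ a ≠ b ∧ a ∉ X ∪ W ∧ b ∉ X ∪ W ∧
      Disjoint X W ∧ U₀ = X ∪ W ∪ {a, b} ∧ S.U ⊆ W ∧ y a = l ∧ y b = l ∧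
      (∀ a' ∈ U₀, scoreA G U₀ a' ≤ scoreA G U₀ a) ∧
      goodTripleCount G U₀ a ≤ X.card * U₀.card ^ 2 + U₀.card * goodPairCount G U₀ a b ∧
      (m : ℝ) ≤ budget G F U₀ + 2
  | .step4 a b c l => (good4Sweep G S.U a b c).Nonempty ∧
      ∃ U₀, SweepInvariant G y F U₀ S.U a b c l m
  | .step5 => (m : ℝ) ≤ 4 * ((F \ S.U).card : ℝ) +
      potential ((hadwigerNumber G + 1) ^ 4) (Fintype.card V) - S.U.card

variable {G y F}

omit [Fintype V] in
theorem mem_good4Sweep_iff {U : Finset V} {a b c d : V} :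
    d ∈ good4Sweep G U a b c ↔ d ∈ U ∧ IsGoodTuple G a b c d := by
  simp only [good4Sweep, Set.mem_ofPred_eq, mem_goodQuadruples_iff]
  constructor
  · exact fun h => ⟨h.1, h.2.2⟩
  · exact fun h => ⟨h.1, by simp [h.1], h.2⟩

theorem budget_add_le {U U₀ : Finset V} {k : ℝ}
    (h : potential ((hadwigerNumber G + 1) ^ 4) U.card + k ≤
      potential ((hadwigerNumber G + 1) ^ 4) U₀.card) (hU : U ⊆ U₀) :
    budget G F U₀ + k ≤ budget G F U := by
  have : ((F \ U₀).card : ℝ) ≤ (F \ U).card := by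
    exact_mod_cast Finset.card_le_card (Finset.sdiff_subset_sdiff le_rfl hU)
  simp only [budget]
  linarith

/-- The budget gains four when an exceptional node is removed. -/
theorem budget_add_four_le {U U₀ : Finset V} {v : V} (hU : U ⊆ U₀) (hvF : v ∈ F) (hv : v ∈ U₀)
    (hvU : v ∉ U) : budget G F U₀ + 4 ≤ budget G F U := by
  have h1 : (F \ U₀).card + 1 ≤ (F \ U).card := by
    rw [← Finset.card_insert_of_notMem (s := F \ U₀) (a := v) (by simp [hv])]
    refine Finset.card_le_card (Finset.insert_subset (by simp [hvF, hvU]) ?_)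
    exact Finset.sdiff_subset_sdiff le_rfl hU
  have h1 : ((F \ U₀).card : ℝ) + 1 ≤ (F \ U).card := by exact_mod_cast h1
  have h2 := potential_mono ((hadwigerNumber G + 1) ^ 4) (Finset.card_le_card hU)
  simp only [budget]
  linarith

/-- On leaving the loop, |U| is in the range where the potential is the identity, so one unit is
reserved for each remaining node. -/
theorem mistakeInvariant_good4Loop (hG : G.Connected) (hh : 1 ≤ hadwigerNumber G) {U : Finset V}
    {m : ℕ} (hm : (m : ℝ) ≤ budget G F U) : MistakeInvariant G y F (good4Loop G U) m := by
  unfold good4Loop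
  split_ifs with h
  · exact hm
  · have := potential_eq_of_le (card_le_of_goodQuadruples_empty hG hh h)
    rw [budget, this] at hm
    exact hm

/-- With nothing left to visit, the nodes counted in `hcount` together with `a`, `b`, `c` are
exactly those labeled in this iteration, and the drop of potential pays for three mistakes. -/
theorem mistakeInvariant_good4Step4 (hG : G.Connected) (hh : 1 ≤ hadwigerNumber G)
    {U₀ U : Finset V} {a b c : V} {l : Bool} {m : ℕ}
    (h : SweepInvariant G y F U₀ U a b c l m) :
    MistakeInvariant G y F (good4Step4 G U a b c l) m := by
  unfold good4Step4
  split_ifs with hne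
  · exact ⟨hne, U₀, h⟩
  · refine mistakeInvariant_good4Loop hG hh (h.hm.trans (budget_add_le ?_ h.hU))
    classical
    have hcard := card_le_of_goodTripleCount_le hG hh h.ha h.hmax h.hcount
    have hfilter : ((U₀ \ {a, b, c}).filter fun v => v ∉ U ∨ IsGoodTuple G a b c v) =
        (U₀ \ U) \ {a, b, c} := by
      ext v
      have hv : ¬ (v ∈ U ∧ IsGoodTuple G a b c v) := fun hv =>
        hne ⟨v, mem_good4Sweep_iff.mpr hv⟩
      simp only [Finset.mem_filter, Finset.mem_sdiff]
      tauto
    have hsub : ({a, b, c} : Finset V) ⊆ U₀ \ U := by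
      intro v hv
      simp only [Finset.mem_insert, Finset.mem_singleton] at hv
      rw [Finset.mem_sdiff]
      rcases hv with rfl | rfl | rfl
      · exact ⟨h.ha, h.haU⟩
      · exact ⟨h.hb, h.hbU⟩
      · exact ⟨h.hc, h.hcU⟩
    have h3 : ({a, b, c} : Finset V).card = 3 := Finset.card_eq_three.mpr
      ⟨a, b, c, h.hab, h.hac, h.hbc, rfl⟩
    have hle := Finset.card_le_card hsub
    rw [hfilter, Finset.card_sdiff_of_subset hsub, h3] at hcard
    rw [h3] at hle
    have hs := Finset.card_sdiff_of_subset h.hU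
    have hUle := Finset.card_le_card h.hU
    refine potential_add_three_le (by omega) ?_
    rwa [Nat.sub_add_cancel hle, hs] at hcard

theorem mistakeInvariant_step1 {U : Finset V} {m : ℕ} {v : V} {p : Bool}
    (hS : MistakeInvariant G y F ⟨U, .step1⟩ m) (hA : Good4Allows G ⟨U, .step1⟩ v p) :
    MistakeInvariant G y F (good4Next G ⟨U, .step1⟩ ⟨v, p, y v⟩)
      (m + if p ≠ y v then 1 else 0) := by
  obtain ⟨hv, hmax⟩ := hA
  have hU : U.erase v ∪ {v} = U := by
    rw [Finset.union_comm, ← Finset.insert_eq, Finset.insert_erase hv]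
  refine ⟨Finset.notMem_erase v U, Finset.Subset.refl _, rfl, ?_, ?_⟩
  · rw [hU]
    exact hmax
  · rw [hU]
    have hS : (m : ℝ) ≤ budget G F U := hS
    push_cast
    split_ifs <;> linarith

theorem mistakeInvariant_step2 {U W : Finset V} {a : V} {l : Bool} {m : ℕ} {v : V} {p : Bool}
    (hS : MistakeInvariant G y F ⟨U, .step2 a l W⟩ m)
    (hA : Good4Allows G ⟨U, .step2 a l W⟩ v p) :
    MistakeInvariant G y F (good4Next G ⟨U, .step2 a l W⟩ ⟨v, p, y v⟩)
      (m + if p ≠ y v then 1 else 0) := by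
  obtain ⟨hv, hvmax, hp⟩ := hA
  obtain ⟨ha, hUW, hya, hmax, hm⟩ := hS
  simp only at hv hUW hvmax
  have hvW := hUW hv
  have hav : a ≠ v := fun h => ha (h ▸ hvW)
  by_cases hmis : p ≠ y v
  · simp only [good4Next, hmis, if_true, MistakeInvariant, ne_eq, not_false_eq_true]
    refine ⟨W ∪ {a}, W \ U, by simp, by simp [hvW], hav, ?_, ?_, ?_, ?_, Finset.Subset.refl _,
      hya, ?_, hmax, ?_, ?_⟩
    · simp only [Finset.mem_union, Finset.mem_sdiff, Finset.mem_erase, not_or, not_and]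
      exact ⟨fun h => absurd h ha, fun _ h => ha (hUW h)⟩
    · simp [hv]
    · exact Finset.disjoint_left.mpr fun x hx hx' =>
        (Finset.mem_sdiff.mp hx).2 (Finset.mem_of_mem_erase hx')
    · ext x
      have := @hUW x
      simp only [Finset.mem_union, Finset.mem_singleton, Finset.mem_sdiff, Finset.mem_erase,
        Finset.mem_insert]
      by_cases hx : x = v
      · subst hx
        tauto
      · tauto
    · rw [hp] at hmis
      revert hmis
      cases l <;> cases y v <;> simp
    · refine goodTripleCount_le_of_max (by simp) (by simp [hvW]) fun b' hb' hne hnot =>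
        hvmax b' ?_
      simp only [Finset.mem_union, Finset.mem_singleton, Finset.mem_sdiff] at hb' hnot
      tauto
    · push_cast
      linarith
  · simp only [good4Next, hmis, if_false, MistakeInvariant]
    exact ⟨ha, (Finset.erase_subset _ _).trans hUW, hya, hmax, by simpa using hm⟩

theorem mistakeInvariant_step3 (hG : G.Connected) (hh : 1 ≤ hadwigerNumber G)
    {U W : Finset V} {a b : V} {l : Bool} {m : ℕ} {v : V} {p : Bool}
    (hS : MistakeInvariant G y F ⟨U, .step3 a b l W⟩ m)
    (hA : Good4Allows G ⟨U, .step3 a b l W⟩ v p) :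
    MistakeInvariant G y F (good4Next G ⟨U, .step3 a b l W⟩ ⟨v, p, y v⟩)
      (m + if p ≠ y v then 1 else 0) := by
  obtain ⟨hv, hvmax, hp⟩ := hA
  obtain ⟨U₀, X, ha, hb, hab, haXW, hbXW, hXW, hU₀, hUW, hya, hyb, hmax, hcount, hm⟩ := hS
  simp only at hv hUW hvmax
  have hvW := hUW hv
  by_cases hmis : p ≠ y v
  · simp only [good4Next, hmis, if_true, ne_eq, not_false_eq_true]
    have hWU₀ : W ⊆ U₀ := by
      rw [hU₀]
      exact fun x hx => by simp [hx]
    have hav : a ≠ v := fun h => haXW (by simp [h, hvW])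
    have hbv : b ≠ v := fun h => hbXW (by simp [h, hvW])
    have haU : a ∉ U := fun h => haXW (by simp [hUW h])
    have hbU : b ∉ U := fun h => hbXW (by simp [hUW h])
    refine mistakeInvariant_good4Step4 hG hh (U₀ := U₀)
      { ha := ha, hb := hb, hc := hWU₀ hvW, hab := hab, hac := hav, hbc := hbv
        hU := (Finset.erase_subset _ _).trans (hUW.trans hWU₀)
        haU := fun h => haU (Finset.mem_of_mem_erase h)
        hbU := fun h => hbU (Finset.mem_of_mem_erase h)
        hcU := Finset.notMem_erase _ _
        hya := hya, hyb := hyb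
        hyc := fun h => hmis (hp.trans h.symm)
        hmax := hmax, hcount := ?_, hm := ?_ }
    · classical
      have hpair := goodPairCount_le_of_max (G := G) (U := U₀) (X := X) (W := W) (Y := W \ U)
        (a := a) (b := b) (c := v)
        (fun x hx => by
          rw [hU₀] at hx
          simp only [Finset.mem_union, Finset.mem_insert, Finset.mem_singleton] at hx
          tauto) hWU₀ hvW
        fun c' hc' hnot => hvmax c' (by
          rw [Finset.mem_sdiff] at hnot
          tauto)
      set R := (U₀ \ {a, b, v}).filter fun x => x ∉ U.erase v ∨ IsGoodTuple G a b v x with hR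
      have hXU₀ : X ⊆ U₀ := by
        rw [hU₀]
        exact fun x hx => by simp [hx]
      have hnotX : ∀ x ∈ X, x ∉ W := fun x hx => Finset.disjoint_left.mp hXW hx
      have h1 : X ∪ W \ U ⊆ R := by
        intro x hx
        have hx' : x ∈ U₀ ∧ x ∉ U ∧ x ∈ X ∪ W := by
          rw [Finset.mem_union, Finset.mem_sdiff] at hx
          rcases hx with hx | hx
          · exact ⟨hXU₀ hx, fun h => hnotX x hx (hUW h), by simp [hx]⟩
          · exact ⟨hWU₀ hx.1, hx.2, by simp [hx.1]⟩
        simp only [hR, Finset.mem_filter, Finset.mem_sdiff, Finset.mem_insert,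
          Finset.mem_singleton, not_or]
        refine ⟨⟨hx'.1, ?_, ?_, ?_⟩, Or.inl fun h => hx'.2.1 (Finset.mem_of_mem_erase h)⟩
        · rintro rfl
          exact haXW hx'.2.2
        · rintro rfl
          exact hbXW hx'.2.2
        · rintro rfl
          exact hx'.2.1 hv
      have h2 : X ∪ W.filter (fun d => IsGoodTuple G a b v d) ⊆ R := by
        refine Finset.union_subset (Finset.subset_union_left.trans h1) fun x hx => ?_
        rw [Finset.mem_filter] at hx
        have hne := hx.2.ne
        simp only [hR, Finset.mem_filter, Finset.mem_sdiff, Finset.mem_insert,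
          Finset.mem_singleton, not_or]
        exact ⟨⟨hWU₀ hx.1, hne.2.2.1.symm, hne.2.2.2.2.1.symm, hne.2.2.2.2.2.symm⟩, Or.inr hx.2⟩
      have h1 := Finset.card_le_card h1
      have h2 := Finset.card_le_card h2
      rw [Finset.card_union_of_disjoint
        (hXW.mono_right Finset.sdiff_subset)] at h1
      rw [Finset.card_union_of_disjoint
        (hXW.mono_right (Finset.filter_subset _ _))] at h2
      refine hcount.trans ?_
      -- `W \ U` and the partners of `v` may overlap, but each is disjoint from `X`. Adding `h1`,
      -- `h2` and |X| ≤ |R| gives the factor 3.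
      calc _ ≤ X.card * U₀.card ^ 2 + U₀.card * (U₀.card * (2 * X.card + (W \ U).card +
            (W.filter fun d => IsGoodTuple G a b v d).card)) := by gcongr
        _ = U₀.card ^ 2 * (3 * X.card + (W \ U).card +
            (W.filter fun d => IsGoodTuple G a b v d).card) := by ring
        _ ≤ U₀.card ^ 2 * (3 * R.card) := Nat.mul_le_mul_left _ (by omega)
        _ = 3 * U₀.card ^ 2 * R.card := by ring
    · push_cast
      linarith
  · simp only [good4Next, hmis, if_false, MistakeInvariant]
    exact ⟨U₀, X, ha, hb, hab, haXW, hbXW, hXW, hU₀, (Finset.erase_subset _ _).trans hUW, hya,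
      hyb, hmax, hcount, by simpa using hm⟩

/-- A mistake gives `v` the label of `c`, so by `hF` one of `a`, `b`, `c`, `v` lies in `F`; all four
have left the unlabeled set, which releases four units. -/
theorem mistakeInvariant_step4 (hG : G.Connected) (hh : 1 ≤ hadwigerNumber G)
    (hF : ∀ a b c d, IsGoodTuple G a b c d → y a = y b → y c = y d → y a ≠ y c →
      a ∈ F ∨ b ∈ F ∨ c ∈ F ∨ d ∈ F)
    {U : Finset V} {a b c : V} {l : Bool} {m : ℕ} {v : V} {p : Bool}
    (hS : MistakeInvariant G y F ⟨U, .step4 a b c l⟩ m)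
    (hA : Good4Allows G ⟨U, .step4 a b c l⟩ v p) :
    MistakeInvariant G y F (good4Next G ⟨U, .step4 a b c l⟩ ⟨v, p, y v⟩)
      (m + if p ≠ y v then 1 else 0) := by
  obtain ⟨hv, hsweep, hp⟩ := hA
  obtain ⟨-, U₀, h⟩ := hS
  simp only at hv h
  rw [mem_good4Sweep_iff] at hsweep
  have hsub : U.erase v ⊆ U₀ := (Finset.erase_subset _ _).trans h.hU
  have haU : a ∉ U.erase v := fun h' => h.haU (Finset.mem_of_mem_erase h')
  have hbU : b ∉ U.erase v := fun h' => h.hbU (Finset.mem_of_mem_erase h')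
  have hcU : c ∉ U.erase v := fun h' => h.hcU (Finset.mem_of_mem_erase h')
  by_cases hmis : p ≠ y v
  · simp only [good4Next, hmis, if_true, ne_eq, not_false_eq_true]
    refine mistakeInvariant_good4Loop hG hh ?_
    have hm : ((m + 1 : ℕ) : ℝ) ≤ budget G F U₀ + 4 := by
      have := h.hm
      push_cast
      linarith
    refine hm.trans ?_
    have hcv : y c = y v := by
      have h1 := h.hyc
      rw [hp] at hmis
      revert h1 hmis
      cases l <;> cases y c <;> cases y v <;> simp
    rcases hF a b c v hsweep.2 (h.hya.trans h.hyb.symm) hcv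
      (fun h' => h.hyc (h'.symm.trans h.hya)) with h' | h' | h' | h'
    · exact budget_add_four_le hsub h' h.ha haU
    · exact budget_add_four_le hsub h' h.hb hbU
    · exact budget_add_four_le hsub h' h.hc hcU
    · exact budget_add_four_le hsub h' (h.hU hv) (Finset.notMem_erase _ _)
  · simp only [good4Next, hmis, if_false]
    refine mistakeInvariant_good4Step4 hG hh (U₀ := U₀)
      { h with hU := hsub, haU := haU, hbU := hbU, hcU := hcU, hcount := ?_, hm := h.hm }
    -- A correctly predicted node passes from those still to be visited to those labeled, so it
    -- stays counted.
    refine h.hcount.trans (Nat.mul_le_mul_left _ (Finset.card_le_card fun x hx => ?_))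
    simp only [Finset.mem_filter] at hx ⊢
    exact ⟨hx.1, hx.2.imp_left fun h' h'' => h' (Finset.mem_of_mem_erase h'')⟩

theorem mistakeInvariant_step5 {U : Finset V} {m : ℕ} {v : V} {p : Bool}
    (hS : MistakeInvariant G y F ⟨U, .step5⟩ m) (hA : Good4Allows G ⟨U, .step5⟩ v p) :
    MistakeInvariant G y F (good4Next G ⟨U, .step5⟩ ⟨v, p, y v⟩)
      (m + if p ≠ y v then 1 else 0) := by
  obtain ⟨hv, -⟩ := hA
  have hS : (m : ℝ) ≤ 4 * ((F \ U).card : ℝ) +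
      potential ((hadwigerNumber G + 1) ^ 4) (Fintype.card V) - U.card := hS
  have h1 : ((F \ U).card : ℝ) ≤ (F \ U.erase v).card := by
    exact_mod_cast Finset.card_le_card
      (Finset.sdiff_subset_sdiff le_rfl (Finset.erase_subset v U))
  have h2 : ((U.erase v).card : ℝ) + 1 = U.card := by
    exact_mod_cast Finset.card_erase_add_one hv
  simp only [good4Next, MistakeInvariant]
  push_cast
  split_ifs <;> linarith

theorem mistakeInvariant_good4Next (hG : G.Connected) (hh : 1 ≤ hadwigerNumber G)
    (hF : ∀ a b c d, IsGoodTuple G a b c d → y a = y b → y c = y d → y a ≠ y c →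
      a ∈ F ∨ b ∈ F ∨ c ∈ F ∨ d ∈ F)
    {S : Good4State V} {m : ℕ} {v : V} {p : Bool}
    (hS : MistakeInvariant G y F S m) (hA : Good4Allows G S v p) :
    MistakeInvariant G y F (good4Next G S ⟨v, p, y v⟩) (m + if p ≠ y v then 1 else 0) := by
  obtain ⟨U, ph⟩ := S
  cases ph with
  | step1 => exact mistakeInvariant_step1 hS hA
  | step2 a l W => exact mistakeInvariant_step2 hS hA
  | step3 a b l W => exact mistakeInvariant_step3 hG hh hS hA
  | step4 a b c l => exact mistakeInvariant_step4 hG hh hF hS hA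
  | step5 => exact mistakeInvariant_step5 hS hA

/-- If the nodes run out during Step 2 or 3, the k ≤ 2 mistakes not yet charged are covered by the
potential of `U₀`, which has at least k nodes. Step 4 always has a node left. -/
theorem MistakeInvariant.le_of_U_eq_empty {S : Good4State V} {m : ℕ}
    (hS : MistakeInvariant G y F S m) (hU : S.U = ∅) :
    (m : ℝ) ≤ 4 * (F.card : ℝ) +
      potential ((hadwigerNumber G + 1) ^ 4) (Fintype.card V) := by
  have hH : 1 ≤ (hadwigerNumber G + 1) ^ 4 := Nat.one_le_pow _ _ (Nat.succ_pos _)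
  have key : ∀ (U₀ : Finset V) (k : ℕ), k ≤ 3 → k ≤ U₀.card → (m : ℝ) ≤ budget G F U₀ + k →
      (m : ℝ) ≤ 4 * (F.card : ℝ) +
        potential ((hadwigerNumber G + 1) ^ 4) (Fintype.card V) := by
    intro U₀ k hk hkU hm
    have h1 := potential_mono ((hadwigerNumber G + 1) ^ 4) hkU
    rw [potential_eq_of_le (by omega)] at h1
    have h2 : ((F \ U₀).card : ℝ) ≤ F.card := by
      exact_mod_cast Finset.card_le_card Finset.sdiff_subset
    rw [budget] at hm
    linarith
  obtain ⟨U, ph⟩ := S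
  simp only at hU
  subst hU
  cases ph with
  | step1 => exact key ∅ 0 (by omega) (by simp) (by simpa [MistakeInvariant] using hS)
  | step2 a l W =>
    obtain ⟨-, -, -, -, hm⟩ := hS
    exact key (W ∪ {a}) 1 (by omega) (Finset.card_pos.mpr ⟨a, by simp⟩) (by simpa using hm)
  | step3 a b l W =>
    obtain ⟨U₀, X, ha, hb, hab, -, -, -, -, -, -, -, -, -, hm⟩ := hS
    refine key U₀ 2 (by omega) ?_ (by simpa using hm)
    rw [← Finset.card_pair hab]
    exact Finset.card_le_card (Finset.insert_subset ha (Finset.singleton_subset_iff.mpr hb))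
  | step4 a b c l =>
    obtain ⟨⟨d, hd⟩, -⟩ := hS
    exact absurd (mem_good4Sweep_iff.mp hd).1 (Finset.notMem_empty _)
  | step5 => simpa [MistakeInvariant] using hS

end Invariant

/-! ### Runs of the algorithm -/

section Run

variable {V : Type*}

/-- Constant families suffice: the distinct indices `i`, `l` in `Fin (hadwigerNumber G + 1)` rule
out the value 0. -/
theorem SimpleGraph.Connected.one_le_hadwigerNumber [Fintype V] {G : SimpleGraph V}
    (hG : G.Connected) : 1 ≤ hadwigerNumber G := by
  obtain ⟨v⟩ := hG.nonempty
  obtain ⟨i, l, -, -, hil, -⟩ := hG.exists_geodesicInterval_inter (fun _ => v) fun _ => v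
  have := i.2
  have := l.2
  have : (i : ℕ) ≠ l := fun h => hil (Fin.ext h)
  omega

/-- A good quadruple whose pairs are separated by `y` contains a node where `y` differs from a
given convex labeling. -/
theorem IsConvexLabeling.exists_flip {G : SimpleGraph V} {y z : V → Bool}
    (hz : IsConvexLabeling G z) {a b c d : V} (h : IsGoodTuple G a b c d) (hab : y a = y b)
    (hcd : y c = y d) (hac : y a ≠ y c) :
    z a ≠ y a ∨ z b ≠ y b ∨ z c ≠ y c ∨ z d ≠ y d := by
  by_contra! hcon
  obtain ⟨ha, hb, hc, hd⟩ := hcon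
  obtain ⟨x, h1, h2⟩ := h.2
  have e1 : z x = y a := hz (y a) a ha b (hb.trans hab.symm) h1
  have e2 : z x = y c := hz (y c) c hc d (hd.trans hcd.symm) h2
  exact hac (e1.symm.trans e2)

theorem good4Loop_U (G : SimpleGraph V) (U : Finset V) : (good4Loop G U).U = U := by
  unfold good4Loop
  split_ifs <;> rfl

variable [DecidableEq V]

theorem good4Step4_U (G : SimpleGraph V) (U : Finset V) (a b c : V) (l : Bool) :
    (good4Step4 G U a b c l).U = U := by
  unfold good4Step4
  split_ifs
  · rfl
  · exact good4Loop_U G U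

theorem good4Next_U (G : SimpleGraph V) (S : Good4State V) (τ : Trial V) :
    (good4Next G S τ).U = S.U.erase τ.node := by
  unfold good4Next
  split <;> (try split_ifs) <;> simp [good4Loop_U, good4Step4_U]

/-- In Step 4 there is always a node left to iterate over. -/
def SweepNonempty (G : SimpleGraph V) (S : Good4State V) : Prop :=
  ∀ a b c l, S.phase = .step4 a b c l → (good4Sweep G S.U a b c).Nonempty

theorem sweepNonempty_good4Loop (G : SimpleGraph V) (U : Finset V) :
    SweepNonempty G (good4Loop G U) := by
  intro a b c l h
  unfold good4Loop at h
  split_ifs at h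

theorem sweepNonempty_good4Step4 (G : SimpleGraph V) (U : Finset V) (a b c : V) (l : Bool) :
    SweepNonempty G (good4Step4 G U a b c l) := by
  unfold good4Step4
  split_ifs with hne
  · intro a' b' c' l' h
    cases h
    exact hne
  · exact sweepNonempty_good4Loop G U

theorem sweepNonempty_good4Next (G : SimpleGraph V) (S : Good4State V) (τ : Trial V) :
    SweepNonempty G (good4Next G S τ) := by
  unfold good4Next
  split
  · intro _ _ _ _ h
    cases h
  · split_ifs <;> intro _ _ _ _ h <;> cases h
  · split_ifs
    · exact sweepNonempty_good4Step4 G _ _ _ _ _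
    · intro _ _ _ _ h
      cases h
  · split_ifs
    · exact sweepNonempty_good4Loop G _
    · exact sweepNonempty_good4Step4 G _ _ _ _ _
  · intro _ _ _ _ h
    cases h

/-- As long as there are unlabeled nodes, the algorithm can perform a trial. -/
theorem exists_good4Allows {G : SimpleGraph V} {S : Good4State V} (hS : SweepNonempty G S)
    (hU : S.U.Nonempty) : ∃ q : V × Bool, Good4Allows G S q.1 q.2 := by
  obtain ⟨U, ph⟩ := S
  cases ph with
  | step1 =>
    obtain ⟨v, hv, hmax⟩ := Finset.exists_max_image U (scoreA G U) hU
    exact ⟨(v, true), hv, hmax⟩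
  | step2 a l W =>
    obtain ⟨v, hv, hmax⟩ := Finset.exists_max_image U (scoreB G (W ∪ {a}) a) hU
    exact ⟨(v, !l), hv, hmax, rfl⟩
  | step3 a b l W =>
    obtain ⟨v, hv, hmax⟩ := Finset.exists_max_image U (scoreC G (W ∪ {a, b}) a b) hU
    exact ⟨(v, l), hv, hmax, rfl⟩
  | step4 a b c l =>
    obtain ⟨d, hd⟩ := hS a b c l rfl
    exact ⟨(d, l), hd.1, hd, rfl⟩
  | step5 =>
    obtain ⟨v, hv⟩ := hU
    exact ⟨(v, true), hv, trivial⟩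

variable [Fintype V]

theorem good4State_append (G : SimpleGraph V) (h : List (Trial V)) (τ : Trial V) :
    good4State G (h ++ [τ]) = good4Next G (good4State G h) τ := by
  simp [good4State]

theorem sweepNonempty_good4State (G : SimpleGraph V) (h : List (Trial V)) :
    SweepNonempty G (good4State G h) := by
  induction h using List.reverseRecOn with
  | nil => exact sweepNonempty_good4Loop G _
  | append_singleton h τ _ =>
    rw [good4State_append]
    exact sweepNonempty_good4Next G _ τ

theorem mem_good4State_U (G : SimpleGraph V) (h : List (Trial V)) (v : V) :
    v ∈ (good4State G h).U ↔ v ∉ h.map Trial.node := by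
  induction h using List.reverseRecOn with
  | nil => simp [good4State, good4Loop_U]
  | append_singleton h τ ih =>
    rw [good4State_append, good4Next_U, Finset.mem_erase, ih]
    simp [not_or, and_comm]

theorem length_trials {W : Type*} (L : Learner W) (y : W → Bool) (t : ℕ) :
    (trials L y t).length = t := by
  induction t with
  | zero => rfl
  | succ t ih => simp [trials, ih]

theorem good4State_U_nonempty (G : SimpleGraph V) {h : List (Trial V)}
    (hlen : h.length < Fintype.card V) : (good4State G h).U.Nonempty := by
  by_contra hne
  rw [Finset.not_nonempty_iff_eq_empty] at hne
  have hsub : (Finset.univ : Finset V) ⊆ (h.map Trial.node).toFinset := fun v _ => by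
    by_contra hv
    rw [List.mem_toFinset, ← mem_good4State_U G, hne] at hv
    exact Finset.notMem_empty v hv
  have := (Finset.card_le_card hsub).trans (List.toFinset_card_le _)
  rw [Finset.card_univ, List.length_map] at this
  omega

theorem exists_isGood4 [Nonempty V] (G : SimpleGraph V) : ∃ L : Learner V, IsGood4 G L := by
  obtain ⟨v₀⟩ := ‹Nonempty V›
  have hex : ∀ h : List (Trial V), ∃ q : V × Bool,
      h.length < Fintype.card V → Good4Allows G (good4State G h) q.1 q.2 := by
    intro h
    by_cases hlen : h.length < Fintype.card V
    · obtain ⟨q, hq⟩ := exists_good4Allows (sweepNonempty_good4State G h)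
        (good4State_U_nonempty G hlen)
      exact ⟨q, fun _ => hq⟩
    -- Default answer for histories of n or more trials, which are never queried during a run.
    · exact ⟨(v₀, true), fun h => absurd h hlen⟩
  choose L hL using hex
  exact ⟨L, fun y t ht => hL _ (by rwa [length_trials])⟩

theorem nodup_trials {G : SimpleGraph V} {L : Learner V} (hL : IsGood4 G L) (y : V → Bool)
    {t : ℕ} (ht : t ≤ Fintype.card V) : ((trials L y t).map Trial.node).Nodup := by
  induction t with
  | zero => exact List.nodup_nil
  | succ t ih =>
    have hv := (mem_good4State_U G _ _).mp (hL y t ht).1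
    rw [trials, List.map_append, List.map_singleton, ← List.concat_eq_append,
      List.nodup_concat]
    exact ⟨hv, ih (by omega)⟩

theorem mem_trials_card {G : SimpleGraph V} {L : Learner V} (hL : IsGood4 G L) (y : V → Bool)
    (v : V) : v ∈ (trials L y (Fintype.card V)).map Trial.node := by
  have hnd := nodup_trials hL y le_rfl
  have hcard := List.toFinset_card_of_nodup hnd
  rw [List.length_map, length_trials] at hcard
  rw [← List.mem_toFinset, Finset.eq_univ_of_card _ hcard]
  exact Finset.mem_univ v

theorem mistakeInvariant_trials {G : SimpleGraph V} (hG : G.Connected) {y : V → Bool}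
    {F : Finset V}
    (hF : ∀ a b c d, IsGoodTuple G a b c d → y a = y b → y c = y d → y a ≠ y c →
      a ∈ F ∨ b ∈ F ∨ c ∈ F ∨ d ∈ F)
    {L : Learner V} (hL : IsGood4 G L) {t : ℕ} (ht : t ≤ Fintype.card V) :
    MistakeInvariant G y F (good4State G (trials L y t))
      ((trials L y t).countP fun τ => τ.guess != τ.label) := by
  induction t with
  | zero =>
    refine mistakeInvariant_good4Loop hG hG.one_le_hadwigerNumber ?_
    simp [budget, trials, Finset.card_univ]
  | succ t ih =>
    have := mistakeInvariant_good4Next hG hG.one_le_hadwigerNumber hF (ih (by omega))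
      (hL y t ht)
    rw [trials, good4State_append, List.countP_append, List.countP_singleton]
    simpa using this

end Run

/-! ### The mistake bound -/

theorem mainTheorem2 {V : Type*} [Fintype V] [DecidableEq V] (G : SimpleGraph V)
    (hG : G.Connected) (hn : 2 ≤ Fintype.card V) :
    (∃ L : Learner V, IsGood4 G L) ∧
    ∀ L : Learner V, IsGood4 G L → ∀ y : V → Bool,
      (((trials L y (Fintype.card V)).map Trial.node).Nodup ∧
        ∀ v : V, v ∈ (trials L y (Fintype.card V)).map Trial.node) ∧
      (mistakes L y : ℝ) ≤
        4 * (minFlips G y : ℝ) +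
          3 * ((hadwigerNumber G : ℝ) + 1) ^ 4 * Real.log (Fintype.card V : ℝ) := by
  have := hG.nonempty
  refine ⟨exists_isGood4 G, fun L hL y => ⟨⟨nodup_trials hL y le_rfl, mem_trials_card hL y⟩, ?_⟩⟩
  obtain ⟨z, hz, hflips⟩ := (isLeast_minFlips G y).1
  set F := Finset.univ.filter fun v => z v ≠ y v with hFdef
  have hF : ∀ a b c d, IsGoodTuple G a b c d → y a = y b → y c = y d → y a ≠ y c →
      a ∈ F ∨ b ∈ F ∨ c ∈ F ∨ d ∈ F := by
    intro a b c d h hab hcd hac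
    simpa [hFdef] using hz.exists_flip h hab hcd hac
  have hinv := mistakeInvariant_trials hG hF hL le_rfl
  have hempty : (good4State G (trials L y (Fintype.card V))).U = ∅ := by
    refine Finset.eq_empty_of_forall_notMem fun v hv => ?_
    exact (mem_good4State_U G _ v).mp hv (mem_trials_card hL y v)
  have h1 := hinv.le_of_U_eq_empty hempty
  have h2 := potential_le_log (H := (hadwigerNumber G + 1) ^ 4)
    (Nat.one_le_pow _ _ (Nat.succ_pos _)) hn
  have h3 : (F.card : ℝ) ≤ minFlips G y := by exact_mod_cast hflips
  push_cast at h2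
  rw [mistakes]
  linarith
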